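/- Let $p$ be a prime, $L$ a finite extension of $\mathbb{Q}_p$ and $K$ a finite extension of $L$, with rings of integers $\mathcal{O}_L,\mathcal{O}_K$ and uniformizers $\pi_L,\pi_K$; let $q$ be the size of the residue field of $K$. Let $f\in\mathcal{O}_K[[x]]$ satisfy $f\equiv \pi_K x \bmod x^2$ and $f\equiv x^{q}\bmod \pi_K$, let $F_K$ be the Lubin–Tate formal group law over $\mathcal{O}_K$ associated to $f$ (the unique formal group law having $f$ as an endomorphism), with addition $\oplus$, so that $[\pi_K](x)=f(x)$, and let $\mathfrak{F}_0$ be the set of roots of $f$ in the maximal ideal of the ring of integers of an algebraic closure $\overline{K}$. The trace operator $\mathscr{L}$ on $\mathcal{O}_K[[x]]$ is defined by $$\mathscr{L}(g)([\pi_K](x))=\sum_{z\in\mathfrak{F}_0}g(x\oplus z).$$ For $\alpha\in\mathcal{O}_L$ let $\mathscr{E}^\alpha_{L,K}$ be the $\mathcal{O}_L$-module of all $g\in\pi_L\mathcal{O}_K[[x]]$ with $\mathscr{L}(g)=\alpha g$, and let $\mathscr{C}_{L,K}$ be the $\mathcal{O}_L$-module of all $g\in\pi_L\mathcal{O}_K[[x]]$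 with $\mathscr{L}(g)=0$. Fix a nonzero root $u_0\in\mathfrak{F}_0$. There is a series $k\in x^{q-1}\mathcal{O}_K[[x]]$ with $k(u_0)=\pi_K/(q-1)$, and for every such $k$ there is a unique $w\in\mathcal{O}_K[[x]]$ with $\mathscr{L}(k)=\pi_K w$; the series $w([\pi_K](x))$ is a unit of $\mathcal{O}_K[[x]]$. If $\pi_L\mid\alpha$, then for every such $k$ (and its $w$) the map $$\rho_\alpha(g)=g(x)-\frac{\alpha\,k(x)\,g([\pi_K](x))}{\pi_K\,w([\pi_K](x))}$$ is an isomorphism of $\mathcal{O}_L$-modules from $\mathscr{E}^\alpha_{L,K}$ onto $\mathscr{C}_{L,K}$. -/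

import Mathlib

noncomputable section

namespace LubinTate

open PowerSeries

/-- A uniformizer of a local ring: a nonzero generator of its maximal ideal. -/
structure IsUniformizer {A : Type*} [CommRing A] [IsLocalRing A] (π : A) : Prop where
  ne_zero : π ≠ 0
  maximalIdeal_eq : IsLocalRing.maximalIdeal A = Ideal.span {π}

/-- A Lubin-Tate series for the uniformizer `π`: a power series `f` with `f ≡ π X` modulo `X ^ 2`
and `f ≡ X ^ q` modulo `π`, where `q` is the cardinality of the residue field. -/
structure IsLubinTateSeries {A : Type*} [CommRing A] [IsLocalRing A] (π : A) (f : A⟦X⟧) :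
    Prop where
  constantCoeff_eq : constantCoeff f = 0
  coeff_one_eq : coeff 1 f = π
  map_residue_eq : f.map (IsLocalRing.residue A) = X ^ Nat.card (IsLocalRing.ResidueField A)

theorem exists_single_of_degree {σ : Type*} {e : σ →₀ ℕ} (he : e.degree = 1) :
    ∃ i, e = Finsupp.single i 1 := by
  classical
  have hne : e ≠ 0 := fun h => by simp [h] at he
  obtain ⟨i, hi⟩ := Finsupp.ne_iff.mp hne
  have hle : Finsupp.single i 1 ≤ e := by
    rw [Finsupp.single_le_iff]
    exact Nat.one_le_iff_ne_zero.mpr hi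
  obtain ⟨c, hc⟩ := le_iff_exists_add.mp hle
  have hdeg : e.degree = 1 + c.degree := by rw [hc]; simp
  have hc0 : c = 0 := (Finsupp.degree_eq_zero_iff c).mp (by omega)
  exact ⟨i, by rw [hc, hc0, add_zero]⟩

/-! ### Existence and uniqueness of the Lubin-Tate formal group law

Below, `fun i => f.subst (X i)` is the family `(f(X_i))_i`, so that `φ.subst` of it is
`φ(f(X_1), ..., f(X_n))`. -/

section
variable {A : Type*} [CommRing A] {σ : Type*} [Finite σ]

theorem coeff_subst_congr (g : A⟦X⟧) {φ ψ : MvPowerSeries σ A} (hφ : φ.constantCoeff = 0)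
    (hψ : ψ.constantCoeff = 0) {m : ℕ}
    (h : ∀ e : σ →₀ ℕ, e.degree < m → MvPowerSeries.coeff e φ = MvPowerSeries.coeff e ψ)
    {e : σ →₀ ℕ} (he : e.degree < m) :
    MvPowerSeries.coeff e (g.subst φ) = MvPowerSeries.coeff e (g.subst ψ) := by
  have hT : φ.truncTotal m = ψ.truncTotal m := by
    ext d
    by_cases hd : d.degree < m
    · rw [MvPowerSeries.coeff_truncTotal _ hd, MvPowerSeries.coeff_truncTotal _ hd, h d hd]
    · rw [MvPowerSeries.coeff_truncTotal_eq_zero _ (not_lt.mp hd),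
        MvPowerSeries.coeff_truncTotal_eq_zero _ (not_lt.mp hd)]
  rw [← MvPowerSeries.coeff_truncTotal _ he, ← MvPowerSeries.coeff_truncTotal _ he,
    PowerSeries.subst, PowerSeries.subst, MvPowerSeries.truncTotal_subst (fun _ => hφ),
    MvPowerSeries.truncTotal_subst (fun _ => hψ), hT]

theorem coeff_subst_sub {π : A} {f : A⟦X⟧} (hf0 : constantCoeff f = 0) (hf1 : coeff 1 f = π)
    {φ ψ : MvPowerSeries σ A} (hφ : φ.constantCoeff = 0) (hψ : ψ.constantCoeff = 0) {m : ℕ}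
    (h : ∀ e : σ →₀ ℕ, e.degree < m → MvPowerSeries.coeff e φ = MvPowerSeries.coeff e ψ)
    {e : σ →₀ ℕ} (he : e.degree = m) :
    MvPowerSeries.coeff e (f.subst φ) - MvPowerSeries.coeff e (f.subst ψ) =
      π * (MvPowerSeries.coeff e φ - MvPowerSeries.coeff e ψ) := by
  obtain ⟨g, hg⟩ : ∃ g : A⟦X⟧, f = X * (X * g + C π) := by
    refine ⟨PowerSeries.mk fun n => coeff (n + 2) f, ?_⟩
    ext n
    rcases n with _ | _ | n
    · simp [hf0]
    · simp [coeff_succ_X_mul, hf1]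
    · simp [coeff_succ_X_mul]
  have hsφ : HasSubst φ := HasSubst.of_constantCoeff_zero hφ
  have hsψ : HasSubst ψ := HasSubst.of_constantCoeff_zero hψ
  have e1 : ∀ χ : MvPowerSeries σ A, HasSubst χ →
      f.subst χ = χ * (χ * g.subst χ + MvPowerSeries.C π) := by
    intro χ hχ
    rw [hg, subst_mul hχ, subst_X hχ, subst_add hχ, subst_mul hχ, subst_X hχ, subst_C]
  have key : f.subst φ - f.subst ψ = MvPowerSeries.C π * (φ - ψ) +
      ((φ - ψ) * ((φ + ψ) * g.subst φ) + ψ * (ψ * (g.subst φ - g.subst ψ))) := by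
    rw [e1 φ hsφ, e1 ψ hsψ]; ring
  have o1 : (m : ℕ∞) ≤ (φ - ψ).order :=
    MvPowerSeries.nat_le_order fun d hd => by rw [map_sub, h d hd, sub_self]
  have o2 : (1 : ℕ∞) ≤ (φ + ψ).order :=
    MvPowerSeries.one_le_order_iff_constCoeff_eq_zero.mpr (by simp [hφ, hψ])
  have o3 : (1 : ℕ∞) ≤ ψ.order := MvPowerSeries.one_le_order_iff_constCoeff_eq_zero.mpr hψ
  have o4 : (m : ℕ∞) ≤ (g.subst φ - g.subst ψ).order :=
    MvPowerSeries.nat_le_order fun d hd => by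
      rw [map_sub, coeff_subst_congr g hφ hψ h hd, sub_self]
  have hm : ((e.degree : ℕ) : ℕ∞) < m + 1 := by
    rw [he]; exact_mod_cast Nat.lt_succ_self m
  have z1 : MvPowerSeries.coeff e ((φ - ψ) * ((φ + ψ) * g.subst φ)) = 0 := by
    refine MvPowerSeries.coeff_of_lt_order (lt_of_lt_of_le hm ?_)
    refine le_trans (add_le_add o1 ?_) MvPowerSeries.le_order_mul
    exact le_trans (le_trans o2 le_self_add) MvPowerSeries.le_order_mul
  have z2 : MvPowerSeries.coeff e (ψ * (ψ * (g.subst φ - g.subst ψ))) = 0 := by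
    refine MvPowerSeries.coeff_of_lt_order (lt_of_lt_of_le hm ?_)
    rw [add_comm]
    refine le_trans (add_le_add o3 ?_) MvPowerSeries.le_order_mul
    exact le_trans (le_trans o4 le_add_self) MvPowerSeries.le_order_mul
  rw [← map_sub, key, map_add, map_add, z1, z2, MvPowerSeries.coeff_C_mul, map_sub]
  ring

theorem hasSubst_family {f : A⟦X⟧} (hf0 : constantCoeff f = 0) :
    MvPowerSeries.HasSubst (fun i : σ => f.subst (MvPowerSeries.X i : MvPowerSeries σ A)) :=
  MvPowerSeries.hasSubst_of_constantCoeff_zero fun i =>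
    constantCoeff_subst_eq_zero (MvPowerSeries.constantCoeff_X i) f hf0

theorem coeff_subst_family {π : A} {f : A⟦X⟧} (hf0 : constantCoeff f = 0) (hf1 : coeff 1 f = π)
    {H : MvPowerSeries σ A} {m : ℕ}
    (h : ∀ e : σ →₀ ℕ, e.degree < m → MvPowerSeries.coeff e H = 0)
    {e : σ →₀ ℕ} (he : e.degree ≤ m) :
    MvPowerSeries.coeff e
      (H.subst (fun i : σ => f.subst (MvPowerSeries.X i : MvPowerSeries σ A))) =
      π ^ m * MvPowerSeries.coeff e H := by
  classical
  obtain ⟨g, hg⟩ : ∃ g : A⟦X⟧, f = X * g := by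
    rw [← X_dvd_iff] at hf0; exact hf0
  have hgπ : constantCoeff g = π := by
    rw [← hf1, hg]; simp [coeff_succ_X_mul]
  have hX : ∀ i : σ, HasSubst (MvPowerSeries.X i : MvPowerSeries σ A) := fun i => HasSubst.X i
  have e1 : ∀ i : σ, f.subst (MvPowerSeries.X i : MvPowerSeries σ A) =
      MvPowerSeries.X i * g.subst (MvPowerSeries.X i : MvPowerSeries σ A) := by
    intro i
    rw [hg, subst_mul (hX i), subst_X (hX i)]
  have e2 : ∀ i : σ, MvPowerSeries.constantCoeff
      (g.subst (MvPowerSeries.X i : MvPowerSeries σ A)) = π := by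
    intro i
    rw [← MvPowerSeries.coeff_zero_eq_constantCoeff_apply, coeff_subst_single]
    simp [hgπ]
  have e3 : ∀ d : σ →₀ ℕ,
      (d.prod fun s k => (f.subst (MvPowerSeries.X s : MvPowerSeries σ A)) ^ k) =
      MvPowerSeries.monomial d 1 *
        d.prod fun s k => (g.subst (MvPowerSeries.X s : MvPowerSeries σ A)) ^ k := by
    intro d
    rw [MvPowerSeries.monomial_one_eq, ← Finsupp.prod_mul]
    exact Finsupp.prod_congr fun s _ => by rw [e1, mul_pow]
  rw [MvPowerSeries.coeff_subst (hasSubst_family hf0), finsum_eq_single _ e]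
  · rcases he.lt_or_eq with he' | he'
    · rw [h e he']; simp
    · rw [e3]
      have := MvPowerSeries.coeff_add_monomial_mul (R := A) e 0
        (φ := e.prod fun s k => (g.subst (MvPowerSeries.X s : MvPowerSeries σ A)) ^ k) 1
      rw [add_zero] at this
      rw [this, MvPowerSeries.coeff_zero_eq_constantCoeff_apply, one_mul, smul_eq_mul, mul_comm]
      congr 1
      rw [Finsupp.prod, map_prod, ← he', Finsupp.degree_apply, ← Finset.prod_pow_eq_pow_sum]
      exact Finset.prod_congr rfl fun s _ => by rw [map_pow, e2]
  · intro d hd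
    by_cases hdm : d.degree < m
    · rw [h d hdm, zero_smul]
    · rw [e3, MvPowerSeries.coeff_monomial_mul, if_neg, smul_zero]
      intro hle
      apply hd
      obtain ⟨c, rfl⟩ := le_iff_exists_add.mp hle
      have hdeg : (d + c).degree = d.degree + c.degree := by simp
      have : c.degree = 0 := by omega
      rw [Finsupp.degree_eq_zero_iff] at this
      rw [this, add_zero]

end

section
variable {A : Type*} [CommRing A] [IsLocalRing A] {σ : Type*} [Finite σ]

theorem card_residueField_ne_zero {π : A} {f : A⟦X⟧} (hf : IsLubinTateSeries π f) :
    Nat.card (IsLocalRing.ResidueField A) ≠ 0 := by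
  intro h0
  have h := congrArg constantCoeff hf.map_residue_eq
  rw [h0, pow_zero, constantCoeff_one, ← coeff_zero_eq_constantCoeff_apply, coeff_map,
    coeff_zero_eq_constantCoeff_apply, hf.constantCoeff_eq, map_zero] at h
  exact zero_ne_one h

theorem dvd_coeff_sub {π : A} (hπ : IsUniformizer π) {f : A⟦X⟧} (hf : IsLubinTateSeries π f)
    {φ : MvPowerSeries σ A} (hφ : φ.constantCoeff = 0) (e : σ →₀ ℕ) :
    π ∣ MvPowerSeries.coeff e (f.subst φ) - MvPowerSeries.coeff e
      (φ.subst (fun i : σ => f.subst (MvPowerSeries.X i : MvPowerSeries σ A))) := by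
  classical
  have hq := card_residueField_ne_zero hf
  have : Finite (IsLocalRing.ResidueField A) := Nat.finite_of_card_ne_zero hq
  have := Fintype.ofFinite (IsLocalRing.ResidueField A)
  obtain ⟨p, hchar⟩ := CharP.exists (IsLocalRing.ResidueField A)
  obtain ⟨n, hp, hcard⟩ := FiniteField.card (IsLocalRing.ResidueField A) p
  have : Fact p.Prime := ⟨hp⟩
  have : ExpChar (IsLocalRing.ResidueField A) p := ExpChar.prime hp
  rw [← Ideal.mem_span_singleton, ← hπ.maximalIdeal_eq, ← IsLocalRing.residue_eq_zero_iff,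
    map_sub, sub_eq_zero, ← MvPowerSeries.coeff_map, ← MvPowerSeries.coeff_map]
  congr 1
  have hcard' : Nat.card (IsLocalRing.ResidueField A) = p ^ (n : ℕ) := by
    rw [Nat.card_eq_fintype_card, hcard]
  have hfrob : iterateFrobenius (IsLocalRing.ResidueField A) p n = RingHom.id _ := by
    ext x
    rw [iterateFrobenius_def, RingHom.id_apply, ← hcard, FiniteField.pow_card]
  have hmapf : ∀ χ : MvPowerSeries σ A, χ.constantCoeff = 0 →
      (f.subst χ).map (IsLocalRing.residue A) =
        (χ.map (IsLocalRing.residue A)) ^ (p ^ (n : ℕ)) := by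
    intro χ hχ
    have h1 : HasSubst (χ.map (IsLocalRing.residue A)) :=
      HasSubst.of_constantCoeff_zero (by simp [hχ])
    rw [PowerSeries.map_subst (HasSubst.of_constantCoeff_zero hχ), hf.map_residue_eq,
      subst_pow h1, subst_X h1, hcard']
  rw [hmapf φ hφ, MvPowerSeries.map_subst (hasSubst_family hf.constantCoeff_eq)]
  have h2 : (fun i : σ => (f.subst (MvPowerSeries.X i : MvPowerSeries σ A)).map
      (IsLocalRing.residue A)) = fun i => MvPowerSeries.X i ^ (p ^ (n : ℕ)) := by
    funext i
    rw [hmapf _ (MvPowerSeries.constantCoeff_X i), MvPowerSeries.map_X]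
  rw [h2, ← MvPowerSeries.map_iterateFrobenius_expand p hp.ne_zero, hfrob, MvPowerSeries.map_id,
    RingHom.id_apply, MvPowerSeries.expand, MvPowerSeries.substAlgHom_apply]

theorem isUnit_one_sub_pow {π : A} (hπ : IsUniformizer π) {n : ℕ} (hn : n ≠ 0) :
    IsUnit (1 - π ^ n) := by
  refine IsLocalRing.isUnit_one_sub_self_of_mem_nonunits _ ?_
  rw [← IsLocalRing.mem_maximalIdeal, hπ.maximalIdeal_eq]
  exact Ideal.pow_mem_of_mem _ (Ideal.mem_span_singleton_self π) n (Nat.pos_of_ne_zero hn)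

theorem eq_of_commutes [IsDomain A] {π : A} (hπ : IsUniformizer π) {f : A⟦X⟧}
    (hf : IsLubinTateSeries π f) {φ ψ : MvPowerSeries σ A} (hφ : φ.constantCoeff = 0)
    (hψ : ψ.constantCoeff = 0)
    (h1 : ∀ i, MvPowerSeries.coeff (Finsupp.single i 1) φ =
      MvPowerSeries.coeff (Finsupp.single i 1) ψ)
    (hcφ : f.subst φ = φ.subst (fun i : σ => f.subst (MvPowerSeries.X i : MvPowerSeries σ A)))
    (hcψ : f.subst ψ = ψ.subst (fun i : σ => f.subst (MvPowerSeries.X i : MvPowerSeries σ A))) :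
    φ = ψ := by
  have key : ∀ m : ℕ, ∀ e : σ →₀ ℕ, e.degree = m →
      MvPowerSeries.coeff e φ = MvPowerSeries.coeff e ψ := by
    intro m
    induction m using Nat.strong_induction_on with
    | _ m ih =>
      intro e he
      have hlt : ∀ d : σ →₀ ℕ, d.degree < m →
          MvPowerSeries.coeff d φ = MvPowerSeries.coeff d ψ := fun d hd => ih _ hd d rfl
      rcases m with _ | _ | m
      · rw [Finsupp.degree_eq_zero_iff] at he
        rw [he, MvPowerSeries.coeff_zero_eq_constantCoeff_apply,
          MvPowerSeries.coeff_zero_eq_constantCoeff_apply, hφ, hψ]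
      · obtain ⟨i, rfl⟩ := exists_single_of_degree he
        exact h1 i
      · have hA := coeff_subst_sub hf.constantCoeff_eq hf.coeff_one_eq hφ hψ hlt he
        have hB := coeff_subst_family hf.constantCoeff_eq hf.coeff_one_eq (H := φ - ψ)
          (m := m + 1 + 1) (fun d hd => by rw [map_sub, hlt d hd, sub_self]) he.le
        rw [← MvPowerSeries.coe_substAlgHom (hasSubst_family hf.constantCoeff_eq), map_sub,
          MvPowerSeries.coe_substAlgHom, map_sub, map_sub, ← hcφ, ← hcψ, hA] at hB
        have hz : π * ((1 - π ^ (m + 1)) *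
            (MvPowerSeries.coeff e φ - MvPowerSeries.coeff e ψ)) = 0 := by
          linear_combination hB
        have hu := isUnit_one_sub_pow hπ (Nat.succ_ne_zero m)
        have := (mul_eq_zero.mp hz).resolve_left hπ.ne_zero
        exact sub_eq_zero.mp ((hu.mul_right_eq_zero).mp this)
  ext e
  exact key _ e rfl

/-- One step of the successive approximation: correct a series in a single degree. -/
theorem exists_step {π : A} (hπ : IsUniformizer π) {f : A⟦X⟧} (hf : IsLubinTateSeries π f)
    (n : ℕ) (φ : MvPowerSeries σ A) (hφ : φ.constantCoeff = 0) :
    ∃ ψ : MvPowerSeries σ A,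
      (∀ e : σ →₀ ℕ, e.degree ≠ n + 2 → MvPowerSeries.coeff e ψ = MvPowerSeries.coeff e φ) ∧
      ∀ e : σ →₀ ℕ, e.degree = n + 2 → MvPowerSeries.coeff e (f.subst ψ) =
        MvPowerSeries.coeff e
          (ψ.subst (fun i : σ => f.subst (MvPowerSeries.X i : MvPowerSeries σ A))) := by
  choose d hd using dvd_coeff_sub hπ hf hφ
  obtain ⟨u, hu⟩ := isUnit_one_sub_pow hπ (Nat.succ_ne_zero n)
  let ψ : MvPowerSeries σ A := fun e =>
    MvPowerSeries.coeff e φ - if e.degree = n + 2 then d e * ↑u⁻¹ else 0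
  have hψ : ∀ e, MvPowerSeries.coeff e ψ =
      MvPowerSeries.coeff e φ - if e.degree = n + 2 then d e * ↑u⁻¹ else 0 := fun e => rfl
  have hne : ∀ e : σ →₀ ℕ, e.degree ≠ n + 2 →
      MvPowerSeries.coeff e ψ = MvPowerSeries.coeff e φ := fun e he => by
    rw [hψ, if_neg he, sub_zero]
  refine ⟨ψ, hne, fun e he => ?_⟩
  have hlt : ∀ e : σ →₀ ℕ, e.degree < n + 2 →
      MvPowerSeries.coeff e ψ = MvPowerSeries.coeff e φ := fun e he => hne e he.ne
  have hψ0 : ψ.constantCoeff = 0 := by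
    rw [← MvPowerSeries.coeff_zero_eq_constantCoeff_apply, hne 0 (by simp),
      MvPowerSeries.coeff_zero_eq_constantCoeff_apply, hφ]
  have hA := coeff_subst_sub hf.constantCoeff_eq hf.coeff_one_eq hψ0 hφ hlt he
  have hB := coeff_subst_family hf.constantCoeff_eq hf.coeff_one_eq (H := ψ - φ)
    (m := n + 2) (fun d hd => by rw [map_sub, hlt d hd, sub_self]) he.le
  rw [← MvPowerSeries.coe_substAlgHom (hasSubst_family hf.constantCoeff_eq), map_sub,
    MvPowerSeries.coe_substAlgHom, map_sub, map_sub] at hB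
  have hE : MvPowerSeries.coeff e ψ - MvPowerSeries.coeff e φ = -(d e * ↑u⁻¹) := by
    rw [hψ, if_pos he]; ring
  have hui : (1 - π ^ (n + 1)) * (↑u⁻¹ : A) = 1 := by
    rw [← Nat.succ_eq_add_one, ← hu, Units.mul_inv]
  rw [hE] at hA hB
  linear_combination hA - hB + hd e - π * d e * hui

theorem exists_commutes {π : A} (hπ : IsUniformizer π) {f : A⟦X⟧} (hf : IsLubinTateSeries π f)
    (c : σ → A) :
    ∃ φ : MvPowerSeries σ A, φ.constantCoeff = 0 ∧
      (∀ i, MvPowerSeries.coeff (Finsupp.single i 1) φ = c i) ∧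
      f.subst φ = φ.subst (fun i : σ => f.subst (MvPowerSeries.X i : MvPowerSeries σ A)) := by
  classical
  have := Fintype.ofFinite σ
  choose S hS1 hS2 using exists_step (σ := σ) hπ hf
  let φ₀ : MvPowerSeries σ A := ∑ i, MvPowerSeries.C (c i) * MvPowerSeries.X i
  have h00 : φ₀.constantCoeff = 0 := by simp [φ₀]
  have h01 : ∀ i, MvPowerSeries.coeff (Finsupp.single i 1) φ₀ = c i := by
    intro i
    simp [φ₀, MvPowerSeries.coeff_index_single_X]
  let s : ℕ → {φ : MvPowerSeries σ A // φ.constantCoeff = 0} := fun n =>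
    Nat.rec ⟨φ₀, h00⟩ (fun n φ => ⟨S n φ.1 φ.2, by
      rw [← MvPowerSeries.coeff_zero_eq_constantCoeff_apply, hS1 n φ.1 φ.2 0 (by simp),
        MvPowerSeries.coeff_zero_eq_constantCoeff_apply, φ.2]⟩) n
  have hs0 : (s 0).1 = φ₀ := rfl
  have hs : ∀ n, (s (n + 1)).1 = S n (s n).1 (s n).2 := fun n => rfl
  have hstab : ∀ (n k : ℕ) (e : σ →₀ ℕ), e.degree < n + 2 →
      MvPowerSeries.coeff e (s (n + k)).1 = MvPowerSeries.coeff e (s n).1 := by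
    intro n k e he
    induction k with
    | zero => rfl
    | succ k ih => rw [← add_assoc, hs, hS1 _ _ _ _ (by omega), ih]
  let φ : MvPowerSeries σ A := fun e => MvPowerSeries.coeff e (s e.degree).1
  have hφ : ∀ (n : ℕ) (e : σ →₀ ℕ), e.degree < n + 2 →
      MvPowerSeries.coeff e φ = MvPowerSeries.coeff e (s n).1 := by
    intro n e he
    have hrfl : MvPowerSeries.coeff e φ = MvPowerSeries.coeff e (s e.degree).1 := rfl
    rw [hrfl]
    rcases le_total e.degree n with hle | hle
    · obtain ⟨k, rfl⟩ := Nat.exists_eq_add_of_le hle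
      exact (hstab _ k e (by omega)).symm
    · obtain ⟨k, hk⟩ := Nat.exists_eq_add_of_le hle
      rw [hk]
      exact hstab n k e he
  have hφ0 : φ.constantCoeff = 0 := by
    rw [← MvPowerSeries.coeff_zero_eq_constantCoeff_apply, hφ 0 0 (by simp), hs0,
      MvPowerSeries.coeff_zero_eq_constantCoeff_apply, h00]
  have hφ1 : ∀ i, MvPowerSeries.coeff (Finsupp.single i 1) φ = c i := fun i => by
    rw [hφ 0 _ (by simp), hs0, h01]
  refine ⟨φ, hφ0, hφ1, ?_⟩
  ext e
  have hlow : ∀ n, ∀ e : σ →₀ ℕ, e.degree < n + 2 →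
      MvPowerSeries.coeff e (f.subst φ) = MvPowerSeries.coeff e (f.subst (s n).1) ∧
      MvPowerSeries.coeff e
        (φ.subst (fun i : σ => f.subst (MvPowerSeries.X i : MvPowerSeries σ A))) =
      MvPowerSeries.coeff e
        ((s n).1.subst (fun i : σ => f.subst (MvPowerSeries.X i : MvPowerSeries σ A))) := by
    intro n e he
    refine ⟨coeff_subst_congr f hφ0 (s n).2 (hφ n) he, ?_⟩
    have hB := coeff_subst_family hf.constantCoeff_eq hf.coeff_one_eq (H := φ - (s n).1)
      (m := n + 2) (fun d hd => by rw [map_sub, hφ n d hd, sub_self]) he.le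
    rw [← MvPowerSeries.coe_substAlgHom (hasSubst_family hf.constantCoeff_eq), map_sub,
      MvPowerSeries.coe_substAlgHom, map_sub, map_sub, hφ n e he, sub_self, mul_zero,
      sub_eq_zero] at hB
    exact hB
  rcases lt_or_ge e.degree 2 with he | he
  · -- degrees zero and one
    rcases Nat.lt_succ_iff_lt_or_eq.mp he with he | he
    · have he0 : e = 0 := (Finsupp.degree_eq_zero_iff e).mp (by omega)
      rw [he0, MvPowerSeries.coeff_zero_eq_constantCoeff_apply,
        MvPowerSeries.coeff_zero_eq_constantCoeff_apply,
        constantCoeff_subst_eq_zero hφ0 f hf.constantCoeff_eq,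
        MvPowerSeries.constantCoeff_subst_eq_zero (hasSubst_family hf.constantCoeff_eq) _ hφ0]
      exact fun i => constantCoeff_subst_eq_zero (MvPowerSeries.constantCoeff_X i) f
        hf.constantCoeff_eq
    · have hz : ∀ d : σ →₀ ℕ, d.degree < 1 → MvPowerSeries.coeff d φ = 0 := fun d hd => by
        rw [(Finsupp.degree_eq_zero_iff d).mp (by omega),
          MvPowerSeries.coeff_zero_eq_constantCoeff_apply, hφ0]
      rw [coeff_subst_family hf.constantCoeff_eq hf.coeff_one_eq hz he.le]
      have hA := coeff_subst_sub hf.constantCoeff_eq hf.coeff_one_eq hφ0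
        (map_zero MvPowerSeries.constantCoeff) (m := 1) (fun d hd => by rw [hz d hd, map_zero]) he
      rw [subst_zero_of_constantCoeff_zero hf.constantCoeff_eq, map_zero] at hA
      simpa using hA
  · obtain ⟨n, hn⟩ := Nat.exists_eq_add_of_le' he
    rw [(hlow (n + 1) e (by omega)).1, (hlow (n + 1) e (by omega)).2, hs]
    exact hS2 n _ _ e hn

end

section
variable {A : Type*} [CommRing A] [IsLocalRing A] [IsDomain A]

/-- There is a formal group law which has `f` as an endomorphism. -/
theorem exists_formalGroup {π : A} (hπ : IsUniformizer π) {f : A⟦X⟧}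
    (hf : IsLubinTateSeries π f) :
    ∃ F : FormalGroup A, f.subst F.toPowerSeries = F.toPowerSeries.subst
      (fun i : Fin 2 => f.subst (MvPowerSeries.X i : MvPowerSeries (Fin 2) A)) := by
  obtain ⟨F, hF0, hF1, hFf⟩ := exists_commutes (σ := Fin 2) hπ hf (fun _ => 1)
  have hf0 := hf.constantCoeff_eq
  have hcc : ∀ a : Fin 2 → MvPowerSeries (Fin 3) A, (∀ i, (a i).constantCoeff = 0) →
      MvPowerSeries.constantCoeff (F.subst a) = 0 := fun a ha =>
    MvPowerSeries.constantCoeff_subst_eq_zero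
      (MvPowerSeries.hasSubst_of_constantCoeff_zero ha) ha hF0
  -- substituting series commuting with `f` in `F`
  have hcomm : ∀ a : Fin 2 → MvPowerSeries (Fin 3) A, (∀ i, (a i).constantCoeff = 0) →
      (∀ i, f.subst (a i) = (a i).subst
        (fun j : Fin 3 => f.subst (MvPowerSeries.X j : MvPowerSeries (Fin 3) A))) →
      f.subst (F.subst a) = (F.subst a).subst
        (fun j : Fin 3 => f.subst (MvPowerSeries.X j : MvPowerSeries (Fin 3) A)) := by
    intro a ha hca
    have hsa : MvPowerSeries.HasSubst a := MvPowerSeries.hasSubst_of_constantCoeff_zero ha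
    have hsF : HasSubst F := HasSubst.of_constantCoeff_zero hF0
    rw [MvPowerSeries.subst_comp_subst_apply hsa (hasSubst_family hf0)]
    have h1 : f.subst (F.subst a) = (f.subst F).subst a := by
      rw [PowerSeries.subst, PowerSeries.subst,
        MvPowerSeries.subst_comp_subst_apply hsF.const hsa]
    rw [h1, hFf, MvPowerSeries.subst_comp_subst_apply (hasSubst_family hf0) hsa]
    congr 1
    funext i
    rw [← hca i, PowerSeries.subst, PowerSeries.subst,
      MvPowerSeries.subst_comp_subst_apply (HasSubst.X i).const hsa]
    congr 1
    funext _
    exact MvPowerSeries.subst_X hsa i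
  have hlin : ∀ a : Fin 2 → MvPowerSeries (Fin 3) A, (∀ i, (a i).constantCoeff = 0) →
      ∀ j, MvPowerSeries.coeff (Finsupp.single j 1) (F.subst a) =
        MvPowerSeries.coeff (Finsupp.single j 1) (a 0) +
        MvPowerSeries.coeff (Finsupp.single j 1) (a 1) := by
    intro a ha j
    have hsa : MvPowerSeries.HasSubst a := MvPowerSeries.hasSubst_of_constantCoeff_zero ha
    obtain ⟨G, hG⟩ : ∃ G, F = MvPowerSeries.X 0 + MvPowerSeries.X 1 + G :=
      ⟨F - (MvPowerSeries.X 0 + MvPowerSeries.X 1), by ring⟩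
    have hGo : ((2 : ℕ) : ℕ∞) ≤ G.order := by
      refine MvPowerSeries.nat_le_order fun d hd => ?_
      have hGd : G = F - (MvPowerSeries.X 0 + MvPowerSeries.X 1) := by rw [hG]; ring
      rcases Nat.lt_succ_iff_lt_or_eq.mp hd with hd | hd
      · rw [(Finsupp.degree_eq_zero_iff d).mp (by omega),
          MvPowerSeries.coeff_zero_eq_constantCoeff_apply, hGd]
        simp [hF0]
      · obtain ⟨i, rfl⟩ := exists_single_of_degree hd
        rw [hGd, map_sub, map_add, hF1]
        fin_cases i <;> simp [MvPowerSeries.coeff_index_single_X]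
    have ho : ((2 : ℕ) : ℕ∞) ≤ (G.subst a).order := by
      refine le_trans ?_ (MvPowerSeries.le_order_subst hsa G)
      refine le_trans hGo ?_
      refine le_mul_of_one_le_left zero_le ?_
      exact le_iInf fun i => MvPowerSeries.one_le_order_iff_constCoeff_eq_zero.mpr (ha i)
    have hz : MvPowerSeries.coeff (Finsupp.single j 1) (G.subst a) = 0 :=
      MvPowerSeries.coeff_of_lt_order (lt_of_lt_of_le (by simp) ho)
    rw [hG, MvPowerSeries.subst_add hsa, MvPowerSeries.subst_add hsa, MvPowerSeries.subst_X hsa,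
      MvPowerSeries.subst_X hsa, map_add, map_add, hz, add_zero]
  have hcX : ∀ j : Fin 3, f.subst (MvPowerSeries.X j : MvPowerSeries (Fin 3) A) =
      (MvPowerSeries.X j : MvPowerSeries (Fin 3) A).subst
        (fun j : Fin 3 => f.subst (MvPowerSeries.X j : MvPowerSeries (Fin 3) A)) := fun j => by
    rw [MvPowerSeries.subst_X (hasSubst_family hf0)]
  have hcX0 : ∀ j : Fin 3, (MvPowerSeries.X j : MvPowerSeries (Fin 3) A).constantCoeff = 0 :=
    fun j => MvPowerSeries.constantCoeff_X j
  have h01 : ∀ i j : Fin 3, ∀ l, MvPowerSeries.constantCoeff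
      ((![MvPowerSeries.X i, MvPowerSeries.X j] : Fin 2 → MvPowerSeries (Fin 3) A) l) = 0 := by
    intro i j l
    fin_cases l <;> simp
  have hC01 : ∀ i j : Fin 3, ∀ l,
      f.subst ((![MvPowerSeries.X i, MvPowerSeries.X j] : Fin 2 → MvPowerSeries (Fin 3) A) l) =
      ((![MvPowerSeries.X i, MvPowerSeries.X j] : Fin 2 → MvPowerSeries (Fin 3) A) l).subst
        (fun j : Fin 3 => f.subst (MvPowerSeries.X j : MvPowerSeries (Fin 3) A)) := by
    intro i j l
    fin_cases l
    · exact hcX i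
    · exact hcX j
  have hL : ∀ l, MvPowerSeries.constantCoeff ((![F.subst ![MvPowerSeries.X 0, MvPowerSeries.X 1],
      MvPowerSeries.X 2] : Fin 2 → MvPowerSeries (Fin 3) A) l) = 0 := by
    intro l
    fin_cases l
    · exact hcc _ (h01 0 1)
    · exact hcX0 2
  have hR : ∀ l, MvPowerSeries.constantCoeff ((![MvPowerSeries.X 0,
      F.subst ![MvPowerSeries.X 1, MvPowerSeries.X 2]] : Fin 2 → MvPowerSeries (Fin 3) A) l) = 0 := by
    intro l
    fin_cases l
    · exact hcX0 0
    · exact hcc _ (h01 1 2)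
  refine ⟨⟨F, hF0, hF1 0, hF1 1, ?_⟩, hFf⟩
  refine eq_of_commutes hπ hf (hcc _ hL) (hcc _ hR) (fun j => ?_) (hcomm _ hL fun l => ?_)
    (hcomm _ hR fun l => ?_)
  · rw [hlin _ hL, hlin _ hR]
    simp only [Matrix.cons_val_zero, Matrix.cons_val_one]
    rw [hlin _ (h01 0 1), hlin _ (h01 1 2)]
    simp only [Matrix.cons_val_zero, Matrix.cons_val_one]
    ring
  · fin_cases l
    · exact hcomm _ (h01 0 1) (hC01 0 1)
    · exact hcX 2
  · fin_cases l
    · exact hcX 0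
    · exact hcomm _ (h01 1 2) (hC01 1 2)

/-- The Lubin-Tate formal group law of `f`: the formal group law `F` such that
`f(F(X, Y)) = F(f(X), f(Y))`. It is unique by `eq_formalGroup`. -/
def formalGroup {π : A} (hπ : IsUniformizer π) {f : A⟦X⟧} (hf : IsLubinTateSeries π f) :
    FormalGroup A :=
  (exists_formalGroup hπ hf).choose

theorem subst_formalGroup {π : A} (hπ : IsUniformizer π) {f : A⟦X⟧}
    (hf : IsLubinTateSeries π f) :
    f.subst (formalGroup hπ hf).toPowerSeries = (formalGroup hπ hf).toPowerSeries.subst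
      (fun i : Fin 2 => f.subst (MvPowerSeries.X i : MvPowerSeries (Fin 2) A)) :=
  (exists_formalGroup hπ hf).choose_spec

theorem eq_formalGroup {π : A} (hπ : IsUniformizer π) {f : A⟦X⟧} (hf : IsLubinTateSeries π f)
    (F : FormalGroup A) (hF : f.subst F.toPowerSeries = F.toPowerSeries.subst
      (fun i : Fin 2 => f.subst (MvPowerSeries.X i : MvPowerSeries (Fin 2) A))) :
    F = formalGroup hπ hf := by
  refine FormalGroup.ext (eq_of_commutes hπ hf F.zero_constantCoeff
    (formalGroup hπ hf).zero_constantCoeff (fun i => ?_) hF (subst_formalGroup hπ hf))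
  fin_cases i
  · exact F.lin_coeff_X.trans (formalGroup hπ hf).lin_coeff_X.symm
  · exact F.lin_coeff_Y.trans (formalGroup hπ hf).lin_coeff_Y.symm

end

/-! ### The trace operator

Finite extensions of `ℚ_[p]` are fields with an embedding into the algebraic closure
`PadicAlgCl p` of `ℚ_[p]`; the values of power series at points of `PadicAlgCl p` are taken in its
completion `ℂ_[p]`. -/

section PAdic

variable (p : ℕ) [Fact p.Prime]

/-- The ring of integers (valuation ring) of a field `K` embedded in `PadicAlgCl p`: the elements
of absolute value at most one. -/
abbrev ringOfIntegers (K : Type*) [Field K] [Algebra K (PadicAlgCl p)] : ValuationSubring K :=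
  ((PadicAlgCl.valued p).v.comap (algebraMap K (PadicAlgCl p))).valuationSubring

theorem mem_ringOfIntegers {K : Type*} [Field K] [Algebra K (PadicAlgCl p)] (x : K) :
    x ∈ ringOfIntegers p K ↔ ‖algebraMap K (PadicAlgCl p) x‖ ≤ 1 := Iff.rfl

variable {p} {K : Type*} [Field K] [Algebra K (PadicAlgCl p)]

/-- The embedding of the ring of integers of `K` into `ℂ_[p]`. -/
def toCp : ringOfIntegers p K →+* ℂ_[p] :=
  (algebraMap (PadicAlgCl p) ℂ_[p]).comp
    ((algebraMap K (PadicAlgCl p)).comp (ringOfIntegers p K).subtype)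

theorem norm_toCp_le (x : ringOfIntegers p K) : ‖toCp x‖ ≤ 1 := by
  have h : ‖algebraMap K (PadicAlgCl p) (x : K)‖ ≤ 1 := (mem_ringOfIntegers p (x : K)).mp x.2
  have e : toCp x = ((algebraMap K (PadicAlgCl p) (x : K) : PadicAlgCl p) : ℂ_[p]) := rfl
  rw [e, PadicComplex.norm_extends]
  exact h

theorem norm_toCp_eq_one {x : ringOfIntegers p K} (hx : IsUnit x) : ‖toCp x‖ = 1 := by
  obtain ⟨y, hxy⟩ := hx.exists_right_inv
  have h : ‖toCp x‖ * ‖toCp y‖ = 1 := by rw [← norm_mul, ← map_mul, hxy, map_one, norm_one]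
  have h1 := norm_toCp_le x
  have h2 := norm_toCp_le y
  nlinarith [norm_nonneg (toCp x), norm_nonneg (toCp y)]

theorem summable_of_norm_le_one {c : ℕ → ℂ_[p]} (hc : ∀ n, ‖c n‖ ≤ 1) {z : ℂ_[p]} (hz : ‖z‖ < 1) :
    Summable fun n => c n * z ^ n := by
  refine Summable.of_norm_bounded (summable_geometric_of_lt_one (norm_nonneg z) hz) fun n => ?_
  rw [norm_mul, norm_pow]
  exact mul_le_of_le_one_left (by positivity) (hc n)

theorem norm_tsum_le_one {c : ℕ → ℂ_[p]} (hc : ∀ n, ‖c n‖ ≤ 1) {z : ℂ_[p]} (hz : ‖z‖ < 1) :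
    ‖∑' n, c n * z ^ n‖ ≤ 1 := by
  refine IsUltrametricDist.norm_tsum_le_of_forall_le_of_nonneg zero_le_one fun n => ?_
  rw [norm_mul, norm_pow]
  exact mul_le_one₀ (hc n) (by positivity) (pow_le_one₀ (norm_nonneg z) hz.le)

theorem tsum_eq_add_mul {c : ℕ → ℂ_[p]} (hc : ∀ n, ‖c n‖ ≤ 1) {z : ℂ_[p]} (hz : ‖z‖ < 1) :
    ∑' n, c n * z ^ n = c 0 + z * ∑' n, c (n + 1) * z ^ n := by
  rw [(summable_of_norm_le_one hc hz).tsum_eq_zero_add, ← tsum_mul_left]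
  congr 1
  · simp
  · exact tsum_congr fun n => by ring

theorem norm_add_mul_eq_one {x y z : ℂ_[p]} (hx : ‖x‖ = 1) (hy : ‖y‖ ≤ 1) (hz : ‖z‖ < 1) :
    ‖x + z * y‖ = 1 := by
  have h : ‖z * y‖ < 1 := by
    rw [norm_mul]
    exact mul_lt_one_of_nonneg_of_lt_one_left (norm_nonneg z) hz hy
  rw [IsUltrametricDist.norm_add_eq_max_of_norm_ne_norm (by rw [hx]; exact h.ne'), hx,
    max_eq_left h.le]

/-- A power series with integral coefficients, one of which is a unit, has finitely many zeros in
the open unit disc. -/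
theorem finite_zeros (q : ℕ) (c : ℕ → ℂ_[p]) (hc : ∀ n, ‖c n‖ ≤ 1) (hq : ‖c q‖ = 1) :
    {z : ℂ_[p] | ‖z‖ < 1 ∧ ∑' n, c n * z ^ n = 0}.Finite := by
  induction q generalizing c with
  | zero =>
    convert Set.finite_empty
    refine Set.eq_empty_iff_forall_notMem.mpr fun z ⟨hz, h⟩ => ?_
    have h1 := norm_add_mul_eq_one hq (norm_tsum_le_one (fun n => hc (n + 1)) hz) hz
    rw [← tsum_eq_add_mul hc hz, h, norm_zero] at h1
    exact zero_ne_one h1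
  | succ q ih =>
    rcases Set.eq_empty_or_nonempty {z : ℂ_[p] | ‖z‖ < 1 ∧ ∑' n, c n * z ^ n = 0} with h0 | ⟨y, hy, hy0⟩
    · rw [h0]; exact Set.finite_empty
    · let b : ℕ → ℂ_[p] := fun n => ∑' j, c (j + (n + 1)) * y ^ j
      have hb : ∀ n, ‖b n‖ ≤ 1 := fun n => norm_tsum_le_one (fun j => hc _) hy
      have hrec : ∀ n, b n = c (n + 1) + y * b (n + 1) := by
        intro n
        have := tsum_eq_add_mul (c := fun j => c (j + (n + 1))) (fun j => hc _) hy
        simp only [zero_add] at this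
        rw [show b n = _ from this]
        congr 2
        exact tsum_congr fun j => by rw [show j + 1 + (n + 1) = j + (n + 1 + 1) by ring]
      have hzero : c 0 + y * b 0 = 0 := by
        rw [← hy0, tsum_eq_add_mul hc hy]
      refine ((ih b hb ?_).insert y).subset fun z ⟨hz, hz0⟩ => ?_
      · rw [hrec]; exact norm_add_mul_eq_one hq (hb _) hy
      · have hs := summable_of_norm_le_one hb hz
        have hs' := summable_of_norm_le_one (fun n => hb (n + 1)) hz
        have key : (z - y) * ∑' n, b n * z ^ n = 0 := by
          have e1 := tsum_eq_add_mul hb hz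
          have e2 : ∑' n, c (n + 1) * z ^ n = (∑' n, b n * z ^ n) - y * ∑' n, b (n + 1) * z ^ n := by
            rw [← tsum_mul_left, ← hs.tsum_sub (hs'.mul_left y)]
            exact tsum_congr fun n => by rw [hrec n]; ring
          rw [tsum_eq_add_mul hc hz, e2] at hz0
          linear_combination hz0 - hzero - y * e1
        rcases mul_eq_zero.mp key with h | h
        · left; exact sub_eq_zero.mp h
        · right; exact ⟨hz, h⟩

/-- The value `g(z)` of a power series with integral coefficients at a point `z` with `‖z‖ < 1`. -/
def evalAt (g : (ringOfIntegers p K)⟦X⟧) (z : PadicAlgCl p) : ℂ_[p] :=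
  ∑' n, toCp (coeff n g) * (z : ℂ_[p]) ^ n

/-- The set of roots of `f` in the maximal ideal of the ring of integers of `PadicAlgCl p`. -/
def torsion (f : (ringOfIntegers p K)⟦X⟧) : Set (PadicAlgCl p) :=
  {z | ‖z‖ < 1 ∧ evalAt f z = 0}

/-- A Lubin-Tate series has finitely many roots in the open unit disc. -/
theorem finite_torsion {π : ringOfIntegers p K} {f : (ringOfIntegers p K)⟦X⟧}
    (hf : IsLubinTateSeries π f) : (torsion f).Finite := by
  have hq : ‖toCp (coeff (Nat.card (IsLocalRing.ResidueField (ringOfIntegers p K))) f)‖ = 1 := by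
    refine norm_toCp_eq_one ?_
    rw [← IsLocalRing.residue_ne_zero_iff_isUnit, ← coeff_map, hf.map_residue_eq, coeff_X_pow_self]
    exact one_ne_zero
  have h := finite_zeros _ (fun n => toCp (coeff n f)) (fun n => norm_toCp_le _) hq
  refine (h.preimage (f := fun z : PadicAlgCl p => (z : ℂ_[p]))
    (UniformSpace.Completion.coe_injective _).injOn).subset fun z ⟨hz, h0⟩ => ?_
  exact ⟨by simpa using hz, h0⟩

/-- The power series `g(X ⊕ z)` for a point `z` with `‖z‖ < 1`, where `⊕` is the addition of the
formal group law `F`: expand `g(F(X, Y))` in powers of `X` and evaluate each coefficient, a power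
series in `Y`, at `Y = z`. -/
def translate (F : FormalGroup (ringOfIntegers p K)) (g : (ringOfIntegers p K)⟦X⟧)
    (z : PadicAlgCl p) : ℂ_[p]⟦X⟧ :=
  PowerSeries.mk fun n => ∑' j : ℕ, toCp (MvPowerSeries.coeff
    (Finsupp.single 0 n + Finsupp.single 1 j) (g.subst F.toPowerSeries)) * (z : ℂ_[p]) ^ j

theorem translate_add (F : FormalGroup (ringOfIntegers p K)) (g h : (ringOfIntegers p K)⟦X⟧)
    {z : PadicAlgCl p} (hz : ‖z‖ < 1) :
    translate F (g + h) z = translate F g z + translate F h z := by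
  have hz' : ‖(z : ℂ_[p])‖ < 1 := by simpa using hz
  ext n
  simp only [translate, map_add, coeff_mk]
  rw [← (summable_of_norm_le_one (fun j => norm_toCp_le _) hz').tsum_add
    (summable_of_norm_le_one (fun j => norm_toCp_le _) hz'),
    subst_add (HasSubst.of_constantCoeff_zero F.zero_constantCoeff)]
  exact tsum_congr fun j => by rw [map_add, map_add, add_mul]

theorem translate_C_mul (F : FormalGroup (ringOfIntegers p K)) (a : ringOfIntegers p K)
    (g : (ringOfIntegers p K)⟦X⟧) (z : PadicAlgCl p) :
    translate F (C a * g) z = C (toCp a) * translate F g z := by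
  ext n
  simp only [translate, coeff_mk, coeff_C_mul]
  rw [← tsum_mul_left, subst_mul (HasSubst.of_constantCoeff_zero F.zero_constantCoeff), subst_C]
  exact tsum_congr fun j => by rw [MvPowerSeries.coeff_C_mul, map_mul, mul_assoc]

theorem translate_zero (F : FormalGroup (ringOfIntegers p K)) (z : PadicAlgCl p) :
    translate F 0 z = 0 := by
  have := translate_C_mul F 0 0 z
  simpa using this

/-- The graph of the trace operator `𝓛` of the Lubin-Tate formal group law of `f`: the series
`h` is `𝓛(g)`, that is, `h(f(X)) = ∑ g(X ⊕ z)`, the sum being over all roots `z` of `f` in the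
maximal ideal of the ring of integers of the algebraic closure. -/
def IsColemanTrace {π : ringOfIntegers p K} (hπ : IsUniformizer π)
    {f : (ringOfIntegers p K)⟦X⟧} (hf : IsLubinTateSeries π f)
    (g h : (ringOfIntegers p K)⟦X⟧) : Prop :=
  PowerSeries.map toCp (h.subst f : (ringOfIntegers p K)⟦X⟧) =
    ∑ z ∈ (finite_torsion hf).toFinset, translate (formalGroup hπ hf) g z

variable {π : ringOfIntegers p K} {hπ : IsUniformizer π} {f : (ringOfIntegers p K)⟦X⟧}
  {hf : IsLubinTateSeries π f}

theorem IsColemanTrace.zero : IsColemanTrace hπ hf 0 0 := by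
  have hs : HasSubst f := HasSubst.of_constantCoeff_zero hf.constantCoeff_eq
  rw [IsColemanTrace, ← coe_substAlgHom hs, map_zero, map_zero]
  exact (Finset.sum_eq_zero fun z _ => translate_zero _ z).symm

theorem IsColemanTrace.add {g₁ g₂ h₁ h₂ : (ringOfIntegers p K)⟦X⟧}
    (H₁ : IsColemanTrace hπ hf g₁ h₁) (H₂ : IsColemanTrace hπ hf g₂ h₂) :
    IsColemanTrace hπ hf (g₁ + g₂) (h₁ + h₂) := by
  have hs : HasSubst f := HasSubst.of_constantCoeff_zero hf.constantCoeff_eq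
  rw [IsColemanTrace, subst_add hs, map_add, H₁, H₂, ← Finset.sum_add_distrib]
  refine Finset.sum_congr rfl fun z hz => (translate_add _ _ _ ?_).symm
  exact ((finite_torsion hf).mem_toFinset.mp hz).1

theorem IsColemanTrace.C_mul (a : ringOfIntegers p K) {g h : (ringOfIntegers p K)⟦X⟧}
    (H : IsColemanTrace hπ hf g h) : IsColemanTrace hπ hf (C a * g) (C a * h) := by
  have hs : HasSubst f := HasSubst.of_constantCoeff_zero hf.constantCoeff_eq
  rw [IsColemanTrace, subst_mul hs, subst_C, map_mul, H, Finset.mul_sum]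
  have hC : PowerSeries.map toCp (MvPowerSeries.C a : (ringOfIntegers p K)⟦X⟧) =
      (C (toCp a) : ℂ_[p]⟦X⟧) := map_C _ _
  exact Finset.sum_congr rfl fun z _ =>
    (congrArg (· * _) hC).trans (translate_C_mul _ a g z).symm


section Relative

variable {L : Type*} [Field L] [Algebra L (PadicAlgCl p)] [Algebra L K]
  [IsScalarTower L K (PadicAlgCl p)]

/-- The ring of integers of `K` is an algebra over the ring of integers of a subfield `L`. -/
instance (priority := low) integersAlgebra :
    Algebra (ringOfIntegers p L) (ringOfIntegers p K) :=
  RingHom.toAlgebra <| ((algebraMap L K).comp (ringOfIntegers p L).subtype).codRestrict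
    (ringOfIntegers p K) fun x => by
      rw [mem_ringOfIntegers, RingHom.comp_apply, ← IsScalarTower.algebraMap_apply L K]
      exact x.2

theorem coe_algebraMap_integers (a : ringOfIntegers p L) :
    ((algebraMap (ringOfIntegers p L) (ringOfIntegers p K) a : ringOfIntegers p K) : K) =
      algebraMap L K (a : L) := rfl

theorem smul_eq_C_algebraMap_mul (a : ringOfIntegers p L) (g : (ringOfIntegers p K)⟦X⟧) :
    a • g = C (algebraMap (ringOfIntegers p L) (ringOfIntegers p K) a) * g := by
  rw [← PowerSeries.smul_eq_C_mul, algebraMap_smul]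

theorem IsColemanTrace.smul (a : ringOfIntegers p L) {g h : (ringOfIntegers p K)⟦X⟧}
    (H : IsColemanTrace hπ hf g h) : IsColemanTrace hπ hf (a • g) (a • h) := by
  rw [smul_eq_C_algebraMap_mul, smul_eq_C_algebraMap_mul]
  exact H.C_mul _

variable (hπ hf)

/-- The module over the ring of integers of `L` of all series `g` that are divisible by `πL` and
satisfy `𝓛(g) = α g`. -/
def eigenspace (πL α : ringOfIntegers p L) :
    Submodule (ringOfIntegers p L) (ringOfIntegers p K)⟦X⟧ where
  carrier := {g | (∃ g' : (ringOfIntegers p K)⟦X⟧, g = πL • g') ∧ IsColemanTrace hπ hf g (α • g)}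
  zero_mem' := ⟨⟨0, (smul_zero _).symm⟩, by rw [smul_zero]; exact IsColemanTrace.zero⟩
  add_mem' := by
    rintro _ _ ⟨⟨g, rfl⟩, hg⟩ ⟨⟨h, rfl⟩, hh⟩
    exact ⟨⟨g + h, (smul_add _ _ _).symm⟩, by rw [smul_add α]; exact hg.add hh⟩
  smul_mem' := by
    rintro a _ ⟨⟨g, rfl⟩, hg⟩
    exact ⟨⟨a • g, smul_comm _ _ _⟩, by rw [smul_comm α a]; exact hg.smul a⟩

/-- The module over the ring of integers of `L` of all series `g` that are divisible by `πL` and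
satisfy `𝓛(g) = 0`. -/
def traceKernel (πL : ringOfIntegers p L) :
    Submodule (ringOfIntegers p L) (ringOfIntegers p K)⟦X⟧ where
  carrier := {g | (∃ g' : (ringOfIntegers p K)⟦X⟧, g = πL • g') ∧ IsColemanTrace hπ hf g 0}
  zero_mem' := ⟨⟨0, (smul_zero _).symm⟩, IsColemanTrace.zero⟩
  add_mem' := by
    rintro _ _ ⟨⟨g, rfl⟩, hg⟩ ⟨⟨h, rfl⟩, hh⟩
    exact ⟨⟨g + h, (smul_add _ _ _).symm⟩, by simpa using hg.add hh⟩
  smul_mem' := by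
    rintro a _ ⟨⟨g, rfl⟩, hg⟩
    exact ⟨⟨a • g, smul_comm _ _ _⟩, by simpa using hg.smul a⟩

variable (π f)

/-- The series `k` lies in `X ^ (q - 1) 𝓞_K⟦X⟧` and `k(u₀) = π / (q - 1)`, where `q` is the
cardinality of the residue field of `K`. -/
structure IsAuxiliarySeries (u₀ : PadicAlgCl p) (k : (ringOfIntegers p K)⟦X⟧) : Prop where
  X_pow_dvd : X ^ (Nat.card (IsLocalRing.ResidueField (ringOfIntegers p K)) - 1) ∣ k
  evalAt_eq : evalAt k u₀ =
    toCp π / ((Nat.card (IsLocalRing.ResidueField (ringOfIntegers p K)) : ℂ_[p]) - 1)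

/-- A power series with integral coefficients, as a power series over the field `K`. -/
def toFractions : (ringOfIntegers p K)⟦X⟧ →+* K⟦X⟧ :=
  PowerSeries.map (ringOfIntegers p K).subtype

/-- `ρ_α(g) = g - α k(X) g(f(X)) / (π w(f(X)))`, computed in `K⟦X⟧`. Here `f = [π]` is the
endomorphism of the Lubin-Tate formal group law of `f` that is attached to `π`. -/
def rho (α : ringOfIntegers p L) (k w g : (ringOfIntegers p K)⟦X⟧) : K⟦X⟧ :=
  toFractions g - C (algebraMap L K α) * toFractions k *
    toFractions (g.subst f : (ringOfIntegers p K)⟦X⟧) *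
    (C (π : K) * toFractions (w.subst f : (ringOfIntegers p K)⟦X⟧))⁻¹

end Relative

end PAdic

end LubinTate

end

open LubinTate PowerSeries

noncomputable section

namespace LubinTate

open PowerSeries

/-! ### Substitution into a series without constant term; power sums -/

section
variable {A : Type*} [CommRing A]

/-! Call a series in `f` any `b(f)` with integral `b`. Three facts about `𝓛` carry the proof.

Existence. Modulo `π` one has `f ≡ X ^ q`, so sorting exponents by their class modulo `q` writes
every series as a combination of `1, X, ..., X ^ (q - 1)` with series in `f` as coefficients;
completeness of `𝓞_K` lifts this from residues (`exists_eq_sum_subst_mul`). Since `f(X ⊕ z) = f(X)`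
for a root `z` (`translate_subst`), applying the relation for `X ^ q` to the translates shows that
all `X ⊕ z` are roots of one monic polynomial of degree `q` over the series in `f`. By Weierstrass
preparation `f` is `X` times an Eisenstein polynomial times a unit, so there are exactly `q`
distinct roots `z` (`card_torsion`), and that polynomial is `∏ (T - (X ⊕ z))`. Newton's identities
put the power sums of the `X ⊕ z`, hence every trace, among the series in `f`
(`exists_isColemanTrace`). Substitution of `f` is injective, so `𝓛(g)` is unique.

Divisibility and linearity. Translation by `z` is trivial modulo the maximal ideal, so the sum of
`q` translates is `q g ≡ 0` and `π ∣ 𝓛(g)` (`IsColemanTrace.C_dvd`). Also `𝓛(b(f) g) = b 𝓛(g)`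
(`IsColemanTrace.subst_mul`).

The auxiliary series. The nonzero roots of `f` are conjugate over `K`, so `k` takes the value `π /
(q - 1)` at all `q - 1` of them, and `k(0) = 0`. Hence `𝓛(k)(0) = π` and `w(0) = 1`, which makes `w`
and `w(f)` units.

Put `γ = α / π`, integral because `π ∣ πL ∣ α`. Then `ρ_α(g) = g - (γ w⁻¹ g)(f) k`, and linearity
gives `𝓛(ρ_α(g)) = 𝓛(g) - α g` whenever `𝓛(g)` is defined: the eigenspace condition on `g` is
exactly the kernel condition on `ρ_α(g)`. Finally `ρ_α` is the identity minus `g ↦ s g(f)` with `X ∣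
s`, an operator that raises the `X`-adic order, so it is bijective on all of `𝓞_K⟦X⟧`
(`exists_sub_mul_subst_eq`) and respects divisibility by `πL` in both directions
(`exists_linearEquiv`). -/

theorem C_dvd_iff_forall_coeff {a : A} {g : A⟦X⟧} : C a ∣ g ↔ ∀ n, a ∣ coeff n g := by
  constructor
  · rintro ⟨r, rfl⟩ n
    exact ⟨coeff n r, coeff_C_mul n r a⟩
  · intro h
    choose r hr using h
    exact ⟨PowerSeries.mk r, by ext n; rw [coeff_C_mul, coeff_mk, hr]⟩

theorem constantCoeff_subst_of_constantCoeff_zero {f : A⟦X⟧} (hf0 : constantCoeff f = 0)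
    (h : A⟦X⟧) : constantCoeff (h.subst f : A⟦X⟧) = constantCoeff h := by
  have hs : HasSubst f := HasSubst.of_constantCoeff_zero hf0
  have h1 : h = C (constantCoeff h) + (h - C (constantCoeff h)) := by ring
  have h2 : constantCoeff ((h - C (constantCoeff h)).subst f : A⟦X⟧) = 0 :=
    constantCoeff_subst_eq_zero hf0 _ (by simp)
  conv_lhs => rw [h1]
  rw [subst_add hs, map_add, h2, subst_C, add_zero]
  exact constantCoeff_C _

/-- If `h = X ^ n r` and `h(f) = 0`, then `f ^ n r(f) = 0`, so `r(f) = 0` in a domain and `r(0) =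
0`; thus `X` can be split off forever. It serves both for uniqueness of traces and, with `X ^ q`
over the residue field, for descending divisibility by `π`. -/
theorem subst_injective [IsDomain A] {f : A⟦X⟧} (hf0 : constantCoeff f = 0) (hf : f ≠ 0) :
    Function.Injective (fun h : A⟦X⟧ => (h.subst f : A⟦X⟧)) := by
  have hs : HasSubst f := HasSubst.of_constantCoeff_zero hf0
  have key : ∀ h : A⟦X⟧, (h.subst f : A⟦X⟧) = 0 → h = 0 := by
    intro h h0
    have hd : ∀ n : ℕ, X ^ n ∣ h := by
      intro n
      induction n with
      | zero => simp
      | succ n ih =>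
        obtain ⟨r, rfl⟩ := ih
        rw [subst_mul hs, subst_pow hs, subst_X hs] at h0
        have h1 := (mul_eq_zero.mp h0).resolve_left (pow_ne_zero n hf)
        have h2 : constantCoeff r = 0 := by
          rw [← constantCoeff_subst_of_constantCoeff_zero hf0, h1, map_zero]
        rw [pow_succ]
        exact mul_dvd_mul_left _ (X_dvd_iff.mpr h2)
    ext n
    exact X_pow_dvd_iff.mp (hd (n + 1)) n (Nat.lt_succ_self n)
  intro g h hgh
  have := key (g - h) (by rw [subst_sub hs]; exact sub_eq_zero.mpr hgh)
  exact sub_eq_zero.mp this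

theorem subst_C_mul {f : A⟦X⟧} (hs : HasSubst f) (a : A) (g : A⟦X⟧) :
    ((C a * g).subst f : A⟦X⟧) = C a * g.subst f := by
  rw [subst_mul hs, subst_C]; rfl

/-- Power sums of a finite family lie in every subring that contains the coefficients of the monic
polynomial with this family of roots. -/
theorem sum_pow_mem {ι : Type*} (s : Finset ι) (τ : ι → A) (S : Subring A)
    (hS : ∀ n, (∏ i ∈ s, (Polynomial.X - Polynomial.C (τ i))).coeff n ∈ S) (k : ℕ) :
    ∑ i ∈ s, τ i ^ k ∈ S := by
  classical
  let θ : s → A := fun i => τ i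
  have hprod : ∏ i ∈ s, (Polynomial.X - Polynomial.C (τ i)) =
      ∏ i : s, (Polynomial.X - Polynomial.C (θ i)) := (Finset.prod_coe_sort s _).symm
  have hesymm : ∀ n, MvPolynomial.aeval θ (MvPolynomial.esymm s ℤ n) ∈ S := by
    intro n
    rw [MvPolynomial.aeval_esymm_eq_multiset_esymm]
    have hcard : (Finset.univ.val.map θ).card = s.card := by
      rw [Multiset.card_map, Finset.card_val, Finset.card_univ, Fintype.card_coe]
    by_cases hn : n ≤ s.card
    -- Vieta: the coefficient of degree `s.card - n` is `(-1) ^ n` times the `n`-th elementary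
    -- symmetric function; beyond `s.card` that function is an empty sum.
    · have h := Multiset.prod_X_sub_C_coeff (Finset.univ.val.map θ) (k := s.card - n)
        (by rw [hcard]; omega)
      rw [hcard, Nat.sub_sub_self hn] at h
      have h2 := hS (s.card - n)
      rw [hprod] at h2
      have h3 : ∏ i : s, (Polynomial.X - Polynomial.C (θ i)) = ((Finset.univ.val.map θ).map
          fun t => Polynomial.X - Polynomial.C t).prod := by
        rw [Multiset.map_map]; rfl
      rw [h3, h] at h2
      have h4 := S.mul_mem (S.pow_mem (S.neg_mem S.one_mem) n) h2
      rwa [← mul_assoc, ← mul_pow, neg_one_mul, neg_neg, one_pow, one_mul] at h4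
    · rw [Multiset.esymm, Multiset.powersetCard_eq_empty _ (by rw [hcard]; omega)]
      simp
  have hpsum : ∀ k, MvPolynomial.aeval θ (MvPolynomial.psum s ℤ k) ∈ S := by
    intro k
    induction k using Nat.strong_induction_on with
    | _ k ih =>
      rcases Nat.eq_zero_or_pos k with rfl | hk
      · simp
      -- Newton's identity in the form that does not divide by `k`, so a subring suffices.
      · rw [MvPolynomial.psum_eq_mul_esymm_sub_sum s ℤ k hk]
        simp only [map_sub, map_mul, map_pow, map_neg, map_one, map_natCast, map_sum]
        refine S.sub_mem (S.mul_mem (S.mul_mem (S.pow_mem (S.neg_mem S.one_mem) _)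
          (natCast_mem S k)) (hesymm k)) (S.sum_mem fun a ha => ?_)
        obtain ⟨ha1, ha2, ha3⟩ := Finset.mem_filter.mp ha
        have ha4 := Finset.HasAntidiagonal.mem_antidiagonal.mp ha1
        exact S.mul_mem (S.mul_mem (S.pow_mem (S.neg_mem S.one_mem) _) (hesymm _))
          (ih _ (by omega))
  have h := hpsum k
  rw [MvPolynomial.psum, map_sum] at h
  simp only [map_pow, MvPolynomial.aeval_X] at h
  rwa [Finset.sum_coe_sort s (fun i => τ i ^ k)] at h

end

/-! ### Series in `f`: reduction modulo `π` and the generators `1, X, ..., X ^ (q - 1)` -/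

section
variable {A : Type*} [CommRing A] [IsLocalRing A]

theorem IsUniformizer.residue_eq_zero_iff {π : A} (hπ : IsUniformizer π) {a : A} :
    IsLocalRing.residue A a = 0 ↔ π ∣ a := by
  rw [IsLocalRing.residue_eq_zero_iff, hπ.maximalIdeal_eq, Ideal.mem_span_singleton]

theorem IsUniformizer.map_residue_eq_zero_iff {π : A} (hπ : IsUniformizer π) {g : A⟦X⟧} :
    g.map (IsLocalRing.residue A) = 0 ↔ C π ∣ g := by
  rw [C_dvd_iff_forall_coeff, PowerSeries.ext_iff]
  exact forall_congr' fun n => by rw [coeff_map, map_zero, hπ.residue_eq_zero_iff]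

theorem IsLubinTateSeries.two_le_card {π : A} {f : A⟦X⟧} (hf : IsLubinTateSeries π f) :
    2 ≤ Nat.card (IsLocalRing.ResidueField A) := by
  have : Finite (IsLocalRing.ResidueField A) :=
    Nat.finite_of_card_ne_zero (card_residueField_ne_zero hf)
  exact Finite.one_lt_card

theorem IsLubinTateSeries.hasSubst {π : A} {f : A⟦X⟧} (hf : IsLubinTateSeries π f) :
    HasSubst f := HasSubst.of_constantCoeff_zero hf.constantCoeff_eq

theorem IsLubinTateSeries.ne_zero {π : A} (hπ : IsUniformizer π) {f : A⟦X⟧}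
    (hf : IsLubinTateSeries π f) : f ≠ 0 := fun h => hπ.ne_zero <| by
  rw [← hf.coeff_one_eq, h, map_zero]

theorem map_residue_subst {π : A} {f : A⟦X⟧} (hf : IsLubinTateSeries π f) (h : A⟦X⟧) :
    PowerSeries.map (IsLocalRing.residue A) (h.subst f) = (h.map (IsLocalRing.residue A)).subst
      (X ^ Nat.card (IsLocalRing.ResidueField A) : (IsLocalRing.ResidueField A)⟦X⟧) := by
  rw [← hf.map_residue_eq]
  exact PowerSeries.map_subst hf.hasSubst h

/-- Over the residue field, substituting `f` is substituting `X ^ q`, which is injective. -/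
theorem C_dvd_of_C_dvd_subst {π : A} (hπ : IsUniformizer π) {f : A⟦X⟧}
    (hf : IsLubinTateSeries π f) {h : A⟦X⟧} (hd : C π ∣ (h.subst f : A⟦X⟧)) : C π ∣ h := by
  rw [← hπ.map_residue_eq_zero_iff, map_residue_subst hf] at hd
  rw [← hπ.map_residue_eq_zero_iff]
  have hq := card_residueField_ne_zero hf
  refine subst_injective (f := X ^ Nat.card (IsLocalRing.ResidueField A)) (by simp [hq])
    (pow_ne_zero _ X_ne_zero) ?_
  refine hd.trans (Eq.symm ?_)
  change ((0 : (IsLocalRing.ResidueField A)⟦X⟧).subst _ : (IsLocalRing.ResidueField A)⟦X⟧) = 0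
  rw [← coe_substAlgHom (HasSubst.X_pow hq), map_zero]

/-- Modulo the uniformizer, every power series is a combination of `1, X, ..., X ^ (q - 1)` with
power series in `f` as coefficients. -/
theorem exists_eq_sum_subst_mul_add {π : A} (hπ : IsUniformizer π) {f : A⟦X⟧}
    (hf : IsLubinTateSeries π f) (g : A⟦X⟧) :
    ∃ (b : ℕ → A⟦X⟧) (r : A⟦X⟧),
      g = ∑ i ∈ Finset.range (Nat.card (IsLocalRing.ResidueField A)), (b i).subst f * X ^ i +
        C π * r := by
  set q := Nat.card (IsLocalRing.ResidueField A) with hq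
  have hq0 : q ≠ 0 := card_residueField_ne_zero hf
  -- `b i` collects the coefficients of `g` at exponents congruent to `i` modulo `q`, so that `g = ∑
  -- b i (X ^ q) X ^ i` exactly and `X ^ q ≡ f`.
  let b : ℕ → A⟦X⟧ := fun i => PowerSeries.mk fun m => coeff (q * m + i) g
  suffices h : C π ∣ g - ∑ i ∈ Finset.range q, (b i).subst f * X ^ i by
    obtain ⟨r, hr⟩ := h
    exact ⟨b, r, by rw [← hr]; ring⟩
  rw [← hπ.map_residue_eq_zero_iff, map_sub, sub_eq_zero, map_sum]
  ext n
  rw [map_sum, Finset.sum_eq_single (n % q)]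
  · rw [map_mul, map_pow, map_X, map_residue_subst hf, ← expand_apply q hq0, coeff_mul_X_pow',
      if_pos (Nat.mod_le n q)]
    have h1 : n - n % q = q * (n / q) := by
      have := Nat.div_add_mod n q; omega
    rw [h1, coeff_expand_mul, coeff_map, coeff_map, coeff_mk, Nat.div_add_mod]
  · intro i hi hne
    rw [map_mul, map_pow, map_X, map_residue_subst hf, ← expand_apply q hq0, coeff_mul_X_pow']
    split_ifs with hin
    · refine coeff_expand_of_not_dvd _ _ _ ?_
      rintro ⟨m, hm⟩
      apply hne
      have hiq := Finset.mem_range.mp hi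
      have : n = i + q * m := by omega
      rw [this, Nat.add_mul_mod_self_left, Nat.mod_eq_of_lt hiq]
    · rfl
  · intro h
    exact absurd (Finset.mem_range.mpr (Nat.mod_lt n (Nat.pos_of_ne_zero hq0))) h

theorem IsUniformizer.mem_maximalIdeal_pow {π : A} (hπ : IsUniformizer π) {n : ℕ} {a : A} :
    a ∈ (IsLocalRing.maximalIdeal A) ^ n • (⊤ : Submodule A A) ↔ π ^ n ∣ a := by
  rw [hπ.maximalIdeal_eq, Ideal.span_singleton_pow, smul_eq_mul, Ideal.mul_top,
    Ideal.mem_span_singleton]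

theorem IsUniformizer.eq_zero_of_forall_pow_dvd {π : A} (hπ : IsUniformizer π)
    [IsHausdorff (IsLocalRing.maximalIdeal A) A] {a : A} (h : ∀ n, π ^ n ∣ a) : a = 0 :=
  IsHausdorff.haus ‹_› a fun n => by
    rw [SModEq.zero, hπ.mem_maximalIdeal_pow]
    exact h n

/-- The sum of the `π`-adic series `∑ π ^ m c m`, characterised by congruences so that no topology
on `A` is needed. -/
theorem IsUniformizer.exists_limit {π : A} (hπ : IsUniformizer π)
    [IsPrecomplete (IsLocalRing.maximalIdeal A) A] (c : ℕ → A) :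
    ∃ s, ∀ n, π ^ n ∣ s - ∑ m ∈ Finset.range n, π ^ m * c m := by
  obtain ⟨s, hs⟩ := IsPrecomplete.prec (I := IsLocalRing.maximalIdeal A) ‹_›
    (f := fun n => ∑ m ∈ Finset.range n, π ^ m * c m) fun {m n} hmn => by
      rw [SModEq.sub_mem, hπ.mem_maximalIdeal_pow, ← dvd_neg, neg_sub,
        ← Finset.sum_Ico_eq_sub _ hmn]
      exact Finset.dvd_sum fun i hi => Dvd.dvd.mul_right
        (pow_dvd_pow π (Finset.mem_Ico.mp hi).1) _
  refine ⟨s, fun n => ?_⟩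
  have h := hs n
  rw [SModEq.sub_mem, hπ.mem_maximalIdeal_pow, ← dvd_neg, neg_sub] at h
  exact h

theorem IsUniformizer.exists_limit_powerSeries {π : A} (hπ : IsUniformizer π)
    [IsPrecomplete (IsLocalRing.maximalIdeal A) A] (c : ℕ → A⟦X⟧) :
    ∃ s, ∀ n, C (π ^ n) ∣ s - ∑ m ∈ Finset.range n, C (π ^ m) * c m := by
  choose s hs using fun j => hπ.exists_limit fun m => coeff j (c m)
  refine ⟨PowerSeries.mk s, fun n => C_dvd_iff_forall_coeff.mpr fun j => ?_⟩
  simp only [map_sub, coeff_mk, map_sum, coeff_C_mul]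
  exact hs j n

/-- Every power series is a combination of `1, X, ..., X ^ (q - 1)` with power series in `f` as
coefficients. -/
theorem exists_eq_sum_subst_mul [IsAdicComplete (IsLocalRing.maximalIdeal A) A] {π : A}
    (hπ : IsUniformizer π) {f : A⟦X⟧} (hf : IsLubinTateSeries π f) (g : A⟦X⟧) :
    ∃ b : ℕ → A⟦X⟧, g =
      ∑ i ∈ Finset.range (Nat.card (IsLocalRing.ResidueField A)), (b i).subst f * X ^ i := by
  set q := Nat.card (IsLocalRing.ResidueField A) with hq
  choose b r hbr using exists_eq_sum_subst_mul_add hπ hf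
  rw [← hq] at hbr
  have hs := hf.hasSubst
  -- Successive remainders: `g = (combination) + π G 1`, then expand `G 1`, and so on. The
  -- coefficient series of all stages are summed `π`-adically.
  let G : ℕ → A⟦X⟧ := fun n => r^[n] g
  have hG : ∀ n, G n = ∑ i ∈ Finset.range q, (b (G n) i).subst f * X ^ i + C π * G (n + 1) := by
    intro n
    rw [show G (n + 1) = r (G n) from Function.iterate_succ_apply' r n g]
    exact hbr _
  have hsum : ∀ n, g = ∑ i ∈ Finset.range q,
      ((∑ m ∈ Finset.range n, C (π ^ m) * b (G m) i).subst f : A⟦X⟧) * X ^ i +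
        C (π ^ n) * G n := by
    intro n
    induction n with
    | zero =>
      have h0 : ((0 : A⟦X⟧).subst f : A⟦X⟧) = 0 := by rw [← coe_substAlgHom hs, map_zero]
      simp [G, h0]
    | succ n ih =>
      conv_lhs => rw [ih, hG n]
      have : ∀ i, ((∑ m ∈ Finset.range (n + 1), C (π ^ m) * b (G m) i).subst f : A⟦X⟧) * X ^ i =
          ((∑ m ∈ Finset.range n, C (π ^ m) * b (G m) i).subst f : A⟦X⟧) * X ^ i +
          C (π ^ n) * ((b (G n) i).subst f * X ^ i) := fun i => by
        rw [Finset.sum_range_succ, subst_add hs, subst_C_mul hs]; ring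
      simp only [this, Finset.sum_add_distrib, ← Finset.mul_sum, pow_succ π n, map_mul]
      ring
  choose s hs' using fun i => hπ.exists_limit_powerSeries fun m => b (G m) i
  refine ⟨s, ?_⟩
  have hd : ∀ n, C (π ^ n) ∣ g - ∑ i ∈ Finset.range q, (s i).subst f * X ^ i := by
    intro n
    choose t ht using fun i => hs' i n
    have hst : ∀ i, s i = (∑ m ∈ Finset.range n, C (π ^ m) * b (G m) i) + C (π ^ n) * t i :=
      fun i => by rw [← ht]; ring
    have : ∀ i, ((s i).subst f : A⟦X⟧) * X ^ i =
        ((∑ m ∈ Finset.range n, C (π ^ m) * b (G m) i).subst f : A⟦X⟧) * X ^ i +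
          C (π ^ n) * ((t i).subst f * X ^ i) := fun i => by
      conv_lhs => rw [hst i, subst_add hs, subst_C_mul hs]
      ring
    refine ⟨G n - ∑ i ∈ Finset.range q, (t i).subst f * X ^ i, ?_⟩
    conv_lhs => rw [hsum n]
    simp only [this, Finset.sum_add_distrib, ← Finset.mul_sum]
    ring
  rw [← sub_eq_zero]
  ext j
  exact hπ.eq_zero_of_forall_pow_dvd fun n => C_dvd_iff_forall_coeff.mp (hd n) j

end

/-! ### The formal group law modulo one variable -/

section
variable {A : Type*} [CommRing A]

/-- Split off the part of a power series in two variables that depends on one variable only. -/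
theorem exists_eq_subst_X_add_X_mul (G : MvPowerSeries (Fin 2) A) {i j : Fin 2} (hij : i ≠ j) :
    ∃ (h : A⟦X⟧) (E : MvPowerSeries (Fin 2) A),
      G = h.subst (MvPowerSeries.X i : MvPowerSeries (Fin 2) A) + MvPowerSeries.X j * E := by
  let h : A⟦X⟧ := PowerSeries.mk fun n => MvPowerSeries.coeff (Finsupp.single i n) G
  have hd : MvPowerSeries.X j ∣ G - h.subst (MvPowerSeries.X i : MvPowerSeries (Fin 2) A) := by
    rw [MvPowerSeries.X_dvd_iff]
    intro m hm
    have hmi : m = Finsupp.single i (m i) := by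
      ext l
      rcases eq_or_ne l i with rfl | hl
      · simp
      · rw [show l = j by omega, hm, Finsupp.single_eq_of_ne hij.symm]
    rw [map_sub, coeff_subst_single, if_pos hmi, coeff_mk, ← hmi, sub_self]
  obtain ⟨E, hE⟩ := hd
  exact ⟨h, E, by rw [← hE]; ring⟩

/-- `F(X, 0) = X`, so the part of `b(F(X, Y))` free of `Y` is `b(X)`. Evaluated at `Y = z`, the
remainder is a multiple of `z`, or of `f(z) = 0` once `f` is applied to both variables. -/
theorem subst_toPowerSeries_eq_add_right (F : FormalGroup A) (b : A⟦X⟧) :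
    ∃ E, b.subst F.toPowerSeries =
      b.subst (MvPowerSeries.X 0 : MvPowerSeries (Fin 2) A) + MvPowerSeries.X 1 * E := by
  obtain ⟨h, E, hE⟩ := exists_eq_subst_X_add_X_mul (b.subst F.toPowerSeries) (i := 0) (j := 1)
    (by decide)
  have hF : HasSubst F.toPowerSeries := HasSubst.of_constantCoeff_zero F.zero_constantCoeff
  have ha : MvPowerSeries.HasSubst ![(X : A⟦X⟧), 0] := MvPowerSeries.HasSubst.X_zero
  have h1 := congrArg (MvPowerSeries.subst ![(X : A⟦X⟧), 0]) hE
  rw [MvPowerSeries.subst_add ha, MvPowerSeries.subst_mul ha, MvPowerSeries.subst_X ha,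
    PowerSeries.subst, PowerSeries.subst, MvPowerSeries.subst_comp_subst_apply hF.const ha,
    MvPowerSeries.subst_comp_subst_apply (HasSubst.X 0).const ha, F.add_zero HasSubst.X',
    MvPowerSeries.subst_X ha] at h1
  have h2 : b = h := by
    have e1 := X_subst b
    have e2 := X_subst h
    rw [PowerSeries.subst] at e1 e2
    simpa [e1, e2] using h1
  exact ⟨E, by rw [hE, h2]⟩

/-- The mirror image, from `F(0, Y) = Y`; it yields the constant term of a translate. -/
theorem subst_toPowerSeries_eq_add_left (F : FormalGroup A) (b : A⟦X⟧) :
    ∃ E, b.subst F.toPowerSeries =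
      b.subst (MvPowerSeries.X 1 : MvPowerSeries (Fin 2) A) + MvPowerSeries.X 0 * E := by
  obtain ⟨h, E, hE⟩ := exists_eq_subst_X_add_X_mul (b.subst F.toPowerSeries) (i := 1) (j := 0)
    (by decide)
  have hF : HasSubst F.toPowerSeries := HasSubst.of_constantCoeff_zero F.zero_constantCoeff
  have ha : MvPowerSeries.HasSubst ![0, (X : A⟦X⟧)] := MvPowerSeries.HasSubst.zero_X
  have h1 := congrArg (MvPowerSeries.subst ![0, (X : A⟦X⟧)]) hE
  rw [MvPowerSeries.subst_add ha, MvPowerSeries.subst_mul ha, MvPowerSeries.subst_X ha,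
    PowerSeries.subst, PowerSeries.subst, MvPowerSeries.subst_comp_subst_apply hF.const ha,
    MvPowerSeries.subst_comp_subst_apply (HasSubst.X 1).const ha, F.zero_add HasSubst.X',
    MvPowerSeries.subst_X ha] at h1
  have h2 : b = h := by
    have e1 := X_subst b
    have e2 := X_subst h
    rw [PowerSeries.subst] at e1 e2
    simpa [e1, e2] using h1
  exact ⟨E, by rw [hE, h2]⟩

end

/-! ### Evaluation and translation by a point of the open unit disc, as ring homomorphisms -/

section
variable {p : ℕ} [Fact p.Prime] {K : Type*} [Field K] [Algebra K (PadicAlgCl p)]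

theorem summable_norm_of_norm_le_one {c : ℕ → ℂ_[p]} (hc : ∀ n, ‖c n‖ ≤ 1) {z : ℂ_[p]}
    (hz : ‖z‖ < 1) : Summable fun n => ‖c n * z ^ n‖ := by
  refine Summable.of_nonneg_of_le (fun _ => norm_nonneg _) (fun n => ?_)
    (summable_geometric_of_lt_one (norm_nonneg z) hz)
  rw [norm_mul, norm_pow]
  exact mul_le_of_le_one_left (by positivity) (hc n)

theorem evalAt_C (a : ringOfIntegers p K) (z : PadicAlgCl p) : evalAt (C a) z = toCp a := by
  rw [evalAt, tsum_eq_single 0 fun n hn => by rw [coeff_C, if_neg hn, map_zero, zero_mul]]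
  simp

theorem evalAt_X (z : PadicAlgCl p) :
    evalAt (X : (ringOfIntegers p K)⟦X⟧) z = (z : ℂ_[p]) := by
  rw [evalAt, tsum_eq_single 1 fun n hn => by rw [coeff_X, if_neg hn, map_zero, zero_mul]]
  simp

/-- Evaluation at a point of the open unit disc. -/
def evalHom {z : PadicAlgCl p} (hz : ‖z‖ < 1) : (ringOfIntegers p K)⟦X⟧ →+* ℂ_[p] where
  toFun g := evalAt g z
  map_one' := by rw [← map_one C, evalAt_C, map_one]
  map_zero' := by rw [← map_zero C, evalAt_C, map_zero]
  map_add' g h := by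
    have hz' : ‖(z : ℂ_[p])‖ < 1 := by simpa using hz
    simp only [evalAt]
    rw [← (summable_of_norm_le_one (fun j => norm_toCp_le _) hz').tsum_add
      (summable_of_norm_le_one (fun j => norm_toCp_le _) hz')]
    exact tsum_congr fun n => by rw [map_add, map_add, add_mul]
  map_mul' g h := by
    have hz' : ‖(z : ℂ_[p])‖ < 1 := by simpa using hz
    simp only [evalAt]
    rw [tsum_mul_tsum_eq_tsum_sum_antidiagonal_of_summable_norm
      (summable_norm_of_norm_le_one (fun j => norm_toCp_le _) hz')
      (summable_norm_of_norm_le_one (fun j => norm_toCp_le _) hz')]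
    refine tsum_congr fun n => ?_
    rw [coeff_mul, map_sum, Finset.sum_mul]
    refine Finset.sum_congr rfl fun a ha => ?_
    rw [map_mul, ← Finset.HasAntidiagonal.mem_antidiagonal.mp ha, pow_add]
    ring

theorem evalHom_apply {z : PadicAlgCl p} (hz : ‖z‖ < 1) (g : (ringOfIntegers p K)⟦X⟧) :
    evalHom hz g = evalAt g z := rfl

/-- Evaluation of the second variable of a power series in two variables at a point of the open
unit disc. -/
def evalSecond {z : PadicAlgCl p} (hz : ‖z‖ < 1) :
    MvPowerSeries (Fin 2) (ringOfIntegers p K) →+* ℂ_[p]⟦X⟧ :=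
  -- `finSuccEquiv` separates the first variable; its coefficients are series in one variable
  -- indexed by `Fin 1`, renamed to `Unit` to become a `PowerSeries` that `evalHom` accepts.
  (PowerSeries.map ((evalHom hz).comp (MvPowerSeries.rename
    (Equiv.ofUnique (Fin 1) Unit).toEmbedding (R := ringOfIntegers p K)).toRingHom)).comp
    (MvPowerSeries.finSuccEquiv (ringOfIntegers p K) 1).toRingEquiv.toRingHom

theorem coeff_evalSecond {z : PadicAlgCl p} (hz : ‖z‖ < 1)
    (G : MvPowerSeries (Fin 2) (ringOfIntegers p K)) (n : ℕ) :
    coeff n (evalSecond hz G) = ∑' j : ℕ, toCp (MvPowerSeries.coeff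
      (Finsupp.single 0 n + Finsupp.single 1 j) G) * (z : ℂ_[p]) ^ j := by
  change ∑' j : ℕ, toCp (PowerSeries.coeff j (MvPowerSeries.rename
    (Equiv.ofUnique (Fin 1) Unit).toEmbedding (R := ringOfIntegers p K)
    (PowerSeries.coeff n (MvPowerSeries.finSuccEquiv (ringOfIntegers p K) 1 G)))) *
    (z : ℂ_[p]) ^ j = _
  refine tsum_congr fun j => ?_
  congr 2
  have h1 : (Finsupp.single () j : Unit →₀ ℕ) =
      Finsupp.embDomain (Equiv.ofUnique (Fin 1) Unit).toEmbedding (Finsupp.single 0 j) := by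
    rw [Finsupp.embDomain_single]
  have h2 : Finsupp.cons n (Finsupp.single (0 : Fin 1) j) =
      (Finsupp.single 0 n + Finsupp.single 1 j : Fin 2 →₀ ℕ) := by
    ext i
    fin_cases i
    · simp
    · change Finsupp.cons n (Finsupp.single (0 : Fin 1) j) (Fin.succ 0) = _
      rw [Finsupp.cons_succ]
      simp
  rw [PowerSeries.coeff, h1]
  refine (MvPowerSeries.coeff_embDomain_rename _ _ _).trans ?_
  refine (MvPowerSeries.coeff_coeff_finSuccEquiv G).trans ?_
  rw [h2]

theorem translate_eq_evalSecond (F : FormalGroup (ringOfIntegers p K))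
    (g : (ringOfIntegers p K)⟦X⟧) {z : PadicAlgCl p} (hz : ‖z‖ < 1) :
    translate F g z = evalSecond hz (g.subst F.toPowerSeries) := by
  ext n
  rw [coeff_evalSecond, translate, coeff_mk]

/-- The ring homomorphism `g ↦ g(X ⊕ z)`. -/
def translateHom (F : FormalGroup (ringOfIntegers p K)) {z : PadicAlgCl p} (hz : ‖z‖ < 1) :
    (ringOfIntegers p K)⟦X⟧ →+* ℂ_[p]⟦X⟧ :=
  (evalSecond hz).comp
    (substAlgHom (HasSubst.of_constantCoeff_zero F.zero_constantCoeff)).toRingHom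

theorem translateHom_apply (F : FormalGroup (ringOfIntegers p K)) {z : PadicAlgCl p}
    (hz : ‖z‖ < 1) (g : (ringOfIntegers p K)⟦X⟧) :
    translateHom F hz g = translate F g z := by
  rw [translate_eq_evalSecond F g hz]
  exact congrArg (evalSecond hz) (congrFun (coe_substAlgHom _) g)

theorem norm_coeff_evalSecond_le {z : PadicAlgCl p} (hz : ‖z‖ < 1)
    (G : MvPowerSeries (Fin 2) (ringOfIntegers p K)) (n : ℕ) :
    ‖coeff n (evalSecond hz G)‖ ≤ 1 := by
  rw [coeff_evalSecond]
  exact norm_tsum_le_one (fun _ => norm_toCp_le _) (by simpa using hz)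

theorem evalSecond_subst_X_zero {z : PadicAlgCl p} (hz : ‖z‖ < 1)
    (h : (ringOfIntegers p K)⟦X⟧) :
    evalSecond hz (h.subst (MvPowerSeries.X 0 : MvPowerSeries (Fin 2) (ringOfIntegers p K))) =
      PowerSeries.map toCp h := by
  ext n
  rw [coeff_evalSecond, tsum_eq_single 0, coeff_map, coeff_subst_single]
  · simp
  · intro j hj
    rw [coeff_subst_single, if_neg, map_zero, zero_mul]
    intro he
    have := DFunLike.congr_fun he 1
    simp at this
    exact hj this

theorem evalSecond_subst_X_one {z : PadicAlgCl p} (hz : ‖z‖ < 1)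
    (h : (ringOfIntegers p K)⟦X⟧) :
    evalSecond hz (h.subst (MvPowerSeries.X 1 : MvPowerSeries (Fin 2) (ringOfIntegers p K))) =
      C (evalAt h z) := by
  ext n
  rw [coeff_evalSecond, coeff_C]
  split_ifs with hn
  · subst hn
    rw [evalAt]
    exact tsum_congr fun j => by rw [coeff_subst_single]; simp
  · refine (tsum_congr fun j => ?_).trans tsum_zero
    rw [coeff_subst_single, if_neg, map_zero, zero_mul]
    intro he
    have := DFunLike.congr_fun he 0
    simp at this
    exact hn this

theorem evalSecond_X_zero {z : PadicAlgCl p} (hz : ‖z‖ < 1) :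
    evalSecond (K := K) hz (MvPowerSeries.X 0) = X := by
  rw [← subst_X (R := ringOfIntegers p K) (HasSubst.X (0 : Fin 2)), evalSecond_subst_X_zero, map_X]

theorem evalSecond_X_one {z : PadicAlgCl p} (hz : ‖z‖ < 1) :
    evalSecond (K := K) hz (MvPowerSeries.X 1) = C (z : ℂ_[p]) := by
  rw [← subst_X (R := ringOfIntegers p K) (HasSubst.X (1 : Fin 2)), evalSecond_subst_X_one, evalAt_X]

/-- The constant term of `g(X ⊕ z)` is `g(z)`. -/
theorem constantCoeff_translate (F : FormalGroup (ringOfIntegers p K))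
    (g : (ringOfIntegers p K)⟦X⟧) {z : PadicAlgCl p} (hz : ‖z‖ < 1) :
    constantCoeff (translate F g z) = evalAt g z := by
  obtain ⟨E, hE⟩ := subst_toPowerSeries_eq_add_left F g
  rw [translate_eq_evalSecond F g hz, hE, map_add, map_mul, evalSecond_subst_X_one,
    evalSecond_X_zero]
  simp

/-- `g(X ⊕ z)` is congruent to `g(X)` modulo the maximal ideal. -/
theorem norm_coeff_translate_sub_lt (F : FormalGroup (ringOfIntegers p K))
    (g : (ringOfIntegers p K)⟦X⟧) {z : PadicAlgCl p} (hz : ‖z‖ < 1) (n : ℕ) :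
    ‖coeff n (translate F g z) - toCp (coeff n g)‖ < 1 := by
  obtain ⟨E, hE⟩ := subst_toPowerSeries_eq_add_right F g
  rw [translate_eq_evalSecond F g hz, hE, map_add, map_mul, evalSecond_subst_X_zero,
    evalSecond_X_one, map_add, coeff_map, add_sub_cancel_left, coeff_C_mul, norm_mul]
  have hz' : ‖(z : ℂ_[p])‖ < 1 := by simpa using hz
  exact mul_lt_one_of_nonneg_of_lt_one_left (norm_nonneg _) hz' (norm_coeff_evalSecond_le hz _ _)

variable {π : ringOfIntegers p K} (hπ : IsUniformizer π) {f : (ringOfIntegers p K)⟦X⟧}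
  (hf : IsLubinTateSeries π f)

/-- Power series in `f` are invariant under translation by the roots of `f`. -/
theorem translate_subst (b : (ringOfIntegers p K)⟦X⟧) {z : PadicAlgCl p} (hz : z ∈ torsion f) :
    translate (formalGroup hπ hf) (b.subst f) z = PowerSeries.map toCp (b.subst f) := by
  set F := formalGroup hπ hf
  have hF : HasSubst F.toPowerSeries := HasSubst.of_constantCoeff_zero F.zero_constantCoeff
  have hs := hf.hasSubst
  have hfam := hasSubst_family (σ := Fin 2) hf.constantCoeff_eq
  obtain ⟨E, hE⟩ := subst_toPowerSeries_eq_add_right F b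
  have h0 : HasSubst (MvPowerSeries.X 0 : MvPowerSeries (Fin 2) (ringOfIntegers p K)) :=
    HasSubst.X 0
  -- `b(f(F(X, Y))) = b(F(f(X), f(Y)))`; expanding `b(F)` modulo its second variable leaves a
  -- remainder divisible by `f(Y)`, which vanishes at `Y = z`.
  have key : PowerSeries.subst F.toPowerSeries (b.subst f : (ringOfIntegers p K)⟦X⟧) =
      PowerSeries.subst
        (MvPowerSeries.X 0 : MvPowerSeries (Fin 2) (ringOfIntegers p K))
        (b.subst f : (ringOfIntegers p K)⟦X⟧) +
      f.subst (MvPowerSeries.X 1 : MvPowerSeries (Fin 2) (ringOfIntegers p K)) * E.subst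
        fun i : Fin 2 => f.subst (MvPowerSeries.X i : MvPowerSeries (Fin 2) (ringOfIntegers p K)) := by
    have e1 : PowerSeries.subst F.toPowerSeries (b.subst f : (ringOfIntegers p K)⟦X⟧) =
        (b.subst F.toPowerSeries).subst fun i : Fin 2 =>
          f.subst (MvPowerSeries.X i : MvPowerSeries (Fin 2) (ringOfIntegers p K)) := by
      rw [subst_comp_subst_apply hs hF, subst_formalGroup hπ hf, PowerSeries.subst,
        PowerSeries.subst, MvPowerSeries.subst_comp_subst_apply hF.const hfam]
    have e2 : MvPowerSeries.subst
        (fun i : Fin 2 => f.subst (MvPowerSeries.X i : MvPowerSeries (Fin 2) (ringOfIntegers p K)))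
        (b.subst (MvPowerSeries.X 0 : MvPowerSeries (Fin 2) (ringOfIntegers p K))) =
        PowerSeries.subst
          (MvPowerSeries.X 0 : MvPowerSeries (Fin 2) (ringOfIntegers p K))
          (b.subst f : (ringOfIntegers p K)⟦X⟧) := by
      rw [subst_comp_subst_apply hs h0, PowerSeries.subst, PowerSeries.subst,
        MvPowerSeries.subst_comp_subst_apply h0.const hfam]
      congr 1
      funext _
      exact MvPowerSeries.subst_X hfam 0
    rw [e1, hE, MvPowerSeries.subst_add hfam, MvPowerSeries.subst_mul hfam,
      MvPowerSeries.subst_X hfam, e2]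
  obtain ⟨hz1, hz2⟩ := hz
  rw [translate_eq_evalSecond F _ hz1, key, map_add, map_mul, evalSecond_subst_X_zero,
    evalSecond_subst_X_one, hz2, map_zero, zero_mul, add_zero]

end

/-! ### Weierstrass preparation for a Lubin-Tate series -/

section
variable {A : Type*} [CommRing A] [IsLocalRing A] [IsDomain A]

/-- A Lubin-Tate series is the product of `X`, an Eisenstein polynomial of degree `q - 1` and a
unit. -/
theorem exists_eisenstein_factor [IsAdicComplete (IsLocalRing.maximalIdeal A) A] {π : A}
    (hπ : IsUniformizer π) {f : A⟦X⟧} (hf : IsLubinTateSeries π f) :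
    ∃ (E : Polynomial A) (U : A⟦X⟧), E.Monic ∧
      E.natDegree + 1 = Nat.card (IsLocalRing.ResidueField A) ∧
      E.IsEisensteinAt (IsLocalRing.maximalIdeal A) ∧ IsUnit U ∧ f = X * (E : A⟦X⟧) * U := by
  have hq := hf.two_le_card
  have hne : f.map (IsLocalRing.residue A) ≠ 0 := by
    rw [hf.map_residue_eq]; exact pow_ne_zero _ X_ne_zero
  obtain ⟨P, U, H⟩ := exists_isWeierstrassFactorization hne
  have hdeg := H.natDegree_eq_toNat_order_map
  rw [hf.map_residue_eq, order_X_pow, ENat.toNat_natCast] at hdeg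
  have hP0 : P.coeff 0 = 0 := by
    have h := congrArg constantCoeff H.eq_mul
    rw [hf.constantCoeff_eq, map_mul, Polynomial.constantCoeff_coe] at h
    exact (mul_eq_zero.mp h.symm).resolve_right (isUnit_iff_constantCoeff.mp H.isUnit).ne_zero
  have hPX : P = Polynomial.X * P.divX := by
    conv_lhs => rw [← Polynomial.X_mul_divX_add P, hP0, map_zero, add_zero]
  have hcoe : f = X * (P.divX : A⟦X⟧) * U := by
    conv_lhs => rw [H.eq_mul, hPX]
    rw [Polynomial.coe_mul, Polynomial.coe_X]
  have hEdeg : P.divX.natDegree + 1 = Nat.card (IsLocalRing.ResidueField A) := by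
    rw [Polynomial.natDegree_divX_eq_natDegree_tsub_one, hdeg]; omega
  have hmonic : P.divX.Monic := by
    have h := H.isDistinguishedAt.monic
    rw [hPX] at h
    exact Polynomial.Monic.of_mul_monic_left Polynomial.monic_X h
  refine ⟨P.divX, U, hmonic, hEdeg, ⟨?_, fun {n} hn => ?_, ?_⟩, H.isUnit, hcoe⟩
  · rw [hmonic.leadingCoeff]
    exact fun h => (IsLocalRing.maximalIdeal.isMaximal A).ne_top ((Ideal.eq_top_iff_one _).mpr h)
  · rw [Polynomial.coeff_divX]
    exact H.isDistinguishedAt.mem (by omega)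
  -- Comparing linear terms gives `π = E(0) U(0)`, so `π ^ 2 ∣ E(0)` would make `π` a unit.
  · have h1 : π = P.divX.coeff 0 * constantCoeff U := by
      rw [← hf.coeff_one_eq]
      conv_lhs => rw [hcoe, mul_assoc, ← zero_add 1, coeff_succ_X_mul]
      rw [coeff_zero_eq_constantCoeff_apply, map_mul, Polynomial.constantCoeff_coe]
    rw [hπ.maximalIdeal_eq, Ideal.span_singleton_pow, Ideal.mem_span_singleton]
    rintro ⟨c, hc⟩
    rw [hc] at h1
    have h2 : π * (1 - π * (c * constantCoeff U)) = 0 := by linear_combination h1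
    have h3 := (mul_eq_zero.mp h2).resolve_left hπ.ne_zero
    have h4 : IsUnit π := isUnit_iff_dvd_one.mpr ⟨_, sub_eq_zero.mp h3⟩
    have h5 : π ∈ IsLocalRing.maximalIdeal A := by
      rw [hπ.maximalIdeal_eq]; exact Ideal.mem_span_singleton_self π
    exact (IsLocalRing.mem_maximalIdeal π).mp h5 h4

end

/-! ### Norms, divisibility and the roots of `f` -/

section
variable {p : ℕ} [Fact p.Prime] {K : Type*} [Field K] [Algebra K (PadicAlgCl p)]

/-- The embedding of the ring of integers of `K` into `PadicAlgCl p`. -/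
def toAlgCl : ringOfIntegers p K →+* PadicAlgCl p :=
  (algebraMap K (PadicAlgCl p)).comp (ringOfIntegers p K).subtype

theorem coe_toAlgCl (x : ringOfIntegers p K) : ((toAlgCl x : PadicAlgCl p) : ℂ_[p]) = toCp x := rfl

theorem norm_toAlgCl (x : ringOfIntegers p K) : ‖toAlgCl x‖ = ‖toCp x‖ := by
  rw [← coe_toAlgCl, PadicComplex.norm_extends]

theorem toCp_injective : Function.Injective (toCp : ringOfIntegers p K → ℂ_[p]) :=
  (algebraMap (PadicAlgCl p) ℂ_[p]).injective.comp
    ((algebraMap K (PadicAlgCl p)).injective.comp Subtype.val_injective)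

theorem dvd_of_norm_le {x y : ringOfIntegers p K} (hx : x ≠ 0) (h : ‖toAlgCl y‖ ≤ ‖toAlgCl x‖) :
    x ∣ y := by
  have hx' : (x : K) ≠ 0 := fun h => hx (Subtype.ext h)
  have hx0 : 0 < ‖toAlgCl x‖ := norm_pos_iff.mpr <| (map_ne_zero (algebraMap K (PadicAlgCl p))).mpr hx'
  have hm : (y : K) / x ∈ ringOfIntegers p K := by
    rw [mem_ringOfIntegers, map_div₀, norm_div]
    exact (div_le_one hx0).mpr h
  exact ⟨⟨_, hm⟩, Subtype.ext (mul_div_cancel₀ (y : K) hx').symm⟩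

variable {π : ringOfIntegers p K} {f : (ringOfIntegers p K)⟦X⟧}

/-- An integral element of norm one has an integral inverse. This converts ultrametric estimates in
`ℂ_[p]` into divisibility by `π`. -/
theorem norm_toCp_lt_one_iff (hπ : IsUniformizer π) {x : ringOfIntegers p K} : ‖toCp x‖ < 1 ↔ π ∣ x := by
  rw [← hπ.residue_eq_zero_iff]
  constructor
  · intro h
    by_contra hx
    rw [← ne_eq, IsLocalRing.residue_ne_zero_iff_isUnit] at hx
    exact h.ne (norm_toCp_eq_one hx)
  · intro h
    refine lt_of_le_of_ne (norm_toCp_le x) fun h1 => ?_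
    have hu : IsUnit x := isUnit_iff_dvd_one.mpr <| dvd_of_norm_le
      (fun h0 => by rw [h0, map_zero, norm_zero] at h1; exact zero_ne_one h1)
      (by rw [norm_toAlgCl, norm_toAlgCl, h1, map_one, norm_one])
    exact (IsLocalRing.residue_ne_zero_iff_isUnit x).mpr hu h

theorem evalAt_coe (P : Polynomial (ringOfIntegers p K)) {z : PadicAlgCl p} (hz : ‖z‖ < 1) :
    evalAt (P : (ringOfIntegers p K)⟦X⟧) z =
      ((P.eval₂ toAlgCl z : PadicAlgCl p) : ℂ_[p]) := by
  have h : (evalHom (K := K) hz).comp (Polynomial.coeToPowerSeries.ringHom) =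
      (algebraMap (PadicAlgCl p) ℂ_[p]).comp (Polynomial.eval₂RingHom toAlgCl z) := by
    refine Polynomial.ringHom_ext (fun a => ?_) ?_
    · simp only [RingHom.comp_apply, Polynomial.coeToPowerSeries.ringHom_apply, Polynomial.coe_C,
        Polynomial.coe_eval₂RingHom, Polynomial.eval₂_C, evalHom_apply, evalAt_C]
      rfl
    · simp only [RingHom.comp_apply, Polynomial.coeToPowerSeries.ringHom_apply, Polynomial.coe_X,
        Polynomial.coe_eval₂RingHom, Polynomial.eval₂_X, evalHom_apply, evalAt_X]
      rfl
  exact RingHom.congr_fun h P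

/-- If `‖z‖ ≥ 1`, the leading term strictly dominates all others, whose coefficients have norm below
one, and the sum cannot vanish. Hence every algebraic root of the Eisenstein factor lies in the
disc. -/
theorem norm_lt_one_of_eval₂_eq_zero (hπ : IsUniformizer π) {E : Polynomial (ringOfIntegers p K)} (hE : E.Monic)
    (hdeg : 0 < E.natDegree) (hEis : E.IsEisensteinAt (IsLocalRing.maximalIdeal _))
    {z : PadicAlgCl p} (hz : E.eval₂ toAlgCl z = 0) : ‖z‖ < 1 := by
  by_contra! h1
  rw [Polynomial.eval₂_eq_sum_range, Finset.sum_range_succ, hE.coeff_natDegree, map_one,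
    one_mul] at hz
  have hne : (Finset.range E.natDegree).Nonempty := Finset.nonempty_range_iff.mpr hdeg.ne'
  obtain ⟨i, hi, hle⟩ := IsUltrametricDist.exists_norm_finsetSum_le (Finset.range E.natDegree)
    (fun i => toAlgCl (E.coeff i) * z ^ i)
  have hi' := Finset.mem_range.mp (hi hne)
  rw [eq_neg_of_add_eq_zero_left hz, norm_neg, norm_mul, norm_pow, norm_pow] at hle
  have hc : ‖toAlgCl (E.coeff i)‖ < 1 := by
    rw [norm_toAlgCl, norm_toCp_lt_one_iff hπ, ← Ideal.mem_span_singleton, ← hπ.maximalIdeal_eq]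
    exact hEis.mem hi'
  have h2 : ‖z‖ ^ i ≤ ‖z‖ ^ E.natDegree := pow_le_pow_right₀ h1 hi'.le
  have h3 : 0 < ‖z‖ ^ i := by positivity
  nlinarith

theorem mem_torsion_iff (hπ : IsUniformizer π) {E : Polynomial (ringOfIntegers p K)}
    {U : (ringOfIntegers p K)⟦X⟧}
    (hE : E.Monic) (hdeg : 0 < E.natDegree)
    (hEis : E.IsEisensteinAt (IsLocalRing.maximalIdeal _)) (hU : IsUnit U)
    (hfE : f = X * (E : (ringOfIntegers p K)⟦X⟧) * U) {z : PadicAlgCl p} :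
    z ∈ torsion f ↔ z = 0 ∨ E.eval₂ toAlgCl z = 0 := by
  have key : ∀ hz : ‖z‖ < 1, evalAt f z = 0 ↔ z = 0 ∨ E.eval₂ toAlgCl z = 0 := by
    intro hz
    have hUz : evalAt U z ≠ 0 := (hU.map (evalHom hz)).ne_zero
    rw [hfE, ← evalHom_apply hz, map_mul, map_mul, evalHom_apply, evalHom_apply, evalHom_apply,
      evalAt_X, evalAt_coe E hz, mul_eq_zero, or_iff_left hUz, mul_eq_zero,
      PadicComplex.coe_eq, PadicComplex.coe_eq, _root_.map_eq_zero, _root_.map_eq_zero]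
  constructor
  · exact fun h => (key h.1).mp h.2
  · intro h
    have hz : ‖z‖ < 1 := by
      rcases h with h | h
      · rw [h, norm_zero]; exact one_pos
      · exact norm_lt_one_of_eval₂_eq_zero hπ hE hdeg hEis h
    exact ⟨hz, (key hz).mpr h⟩

theorem irreducible_map_of_isEisensteinAt {E : Polynomial (ringOfIntegers p K)}
    (hE : E.Monic) (hdeg : 0 < E.natDegree)
    (hEis : E.IsEisensteinAt (IsLocalRing.maximalIdeal _)) :
    Irreducible (E.map (algebraMap (ringOfIntegers p K) K)) :=
  hE.irreducible_iff_irreducible_map_fraction_map.mp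
    (hEis.irreducible inferInstance hE.isPrimitive hdeg)

theorem map_toAlgCl (P : Polynomial (ringOfIntegers p K)) :
    P.map toAlgCl = (P.map (algebraMap (ringOfIntegers p K) K)).map
      (algebraMap K (PadicAlgCl p)) := by
  rw [Polynomial.map_map]; rfl

/-! ### The trace: uniqueness, linearity over series in `f`, divisibility by `π` -/

section
variable {hπ : IsUniformizer π} {hf : IsLubinTateSeries π f}

theorem IsColemanTrace.unique {g h₁ h₂ : (ringOfIntegers p K)⟦X⟧}
    (H₁ : IsColemanTrace hπ hf g h₁) (H₂ : IsColemanTrace hπ hf g h₂) : h₁ = h₂ :=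
  subst_injective hf.constantCoeff_eq (hf.ne_zero hπ)
    (map_injective _ toCp_injective (H₁.trans H₂.symm))

/-- The trace is linear over the ring of power series in `f`. -/
theorem IsColemanTrace.subst_mul (b : (ringOfIntegers p K)⟦X⟧) {g h : (ringOfIntegers p K)⟦X⟧}
    (H : IsColemanTrace hπ hf g h) : IsColemanTrace hπ hf (b.subst f * g) (b * h) := by
  rw [IsColemanTrace, PowerSeries.subst_mul hf.hasSubst, map_mul, H, Finset.mul_sum]
  refine Finset.sum_congr rfl fun z hz => ?_
  have hz' := (finite_torsion hf).mem_toFinset.mp hz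
  rw [← translateHom_apply _ hz'.1 (b.subst f * g), map_mul, translateHom_apply, translateHom_apply,
    translate_subst hπ hf b hz']

/-- The uniformizer divides every trace. -/
theorem IsColemanTrace.C_dvd (hcard : (finite_torsion hf).toFinset.card =
      Nat.card (IsLocalRing.ResidueField (ringOfIntegers p K)))
    {g h : (ringOfIntegers p K)⟦X⟧} (H : IsColemanTrace hπ hf g h) : C π ∣ h := by
  refine C_dvd_of_C_dvd_subst hπ hf (C_dvd_iff_forall_coeff.mpr fun n => ?_)
  rw [← norm_toCp_lt_one_iff hπ, ← coeff_map, H, map_sum]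
  have hq : ‖(Nat.card (IsLocalRing.ResidueField (ringOfIntegers p K)) : ℂ_[p])‖ < 1 := by
    rw [← map_natCast (toCp (K := K)), norm_toCp_lt_one_iff hπ, ← hπ.residue_eq_zero_iff, map_natCast]
    have : Finite (IsLocalRing.ResidueField (ringOfIntegers p K)) :=
      Nat.finite_of_card_ne_zero (card_residueField_ne_zero hf)
    have := Fintype.ofFinite (IsLocalRing.ResidueField (ringOfIntegers p K))
    rw [Nat.card_eq_fintype_card, FiniteField.cast_card_eq_zero]
  -- Comparing each translate with `g` itself: `q` has norm below one, and so has every difference.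
  have hsplit : ∑ z ∈ (finite_torsion hf).toFinset, coeff n (translate (formalGroup hπ hf) g z) =
      Nat.card (IsLocalRing.ResidueField (ringOfIntegers p K)) * toCp (coeff n g) +
      ∑ z ∈ (finite_torsion hf).toFinset,
        (coeff n (translate (formalGroup hπ hf) g z) - toCp (coeff n g)) := by
    rw [Finset.sum_sub_distrib, Finset.sum_const, hcard, nsmul_eq_mul]; ring
  rw [hsplit]
  refine lt_of_le_of_lt (IsUltrametricDist.norm_add_le_max _ _) (max_lt ?_ ?_)
  · rw [norm_mul]
    exact mul_lt_one_of_nonneg_of_lt_one_left (norm_nonneg _) hq (norm_toCp_le _)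
  · have hne : (finite_torsion hf).toFinset.Nonempty := by
      rw [← Finset.card_pos, hcard]
      exact Nat.pos_of_ne_zero (card_residueField_ne_zero hf)
    obtain ⟨z, hz, hle⟩ := IsUltrametricDist.exists_norm_finsetSum_le (finite_torsion hf).toFinset
      (fun z => coeff n (translate (formalGroup hπ hf) g z) - toCp (coeff n g))
    exact lt_of_le_of_lt hle (norm_coeff_translate_sub_lt _ g
      ((finite_torsion hf).mem_toFinset.mp (hz hne)).1 n)

end

/-! ### Number and conjugacy of the roots; existence of the trace -/

variable [IsAdicComplete (IsLocalRing.maximalIdeal (ringOfIntegers p K)) (ringOfIntegers p K)]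

/-- A Lubin-Tate series has exactly `q` roots in the open unit disc. -/
theorem card_torsion (hπ : IsUniformizer π) (hf : IsLubinTateSeries π f) :
     (finite_torsion hf).toFinset.card =
    Nat.card (IsLocalRing.ResidueField (ringOfIntegers p K)) := by
  classical
  obtain ⟨E, U, hE, hdeg, hEis, hU, hfE⟩ := exists_eisenstein_factor hπ hf
  have hq := hf.two_le_card
  have hdeg0 : 0 < E.natDegree := by omega
  have hirr := irreducible_map_of_isEisensteinAt hE hdeg0 hEis
  have hchar : CharZero K := by
    have := (algebraMap K (PadicAlgCl p)).charZero_iff (algebraMap K (PadicAlgCl p)).injective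
    exact this.mpr inferInstance
  have hsep : (E.map toAlgCl).Separable := by
    rw [map_toAlgCl]; exact hirr.separable.map
  have hne : E.map toAlgCl ≠ 0 := (hE.map _).ne_zero
  -- The constant term of an Eisenstein polynomial is outside the square of the maximal ideal, so it
  -- is nonzero and `0` is one extra root of `f`.
  have h0 : (0 : PadicAlgCl p) ∉ (E.map toAlgCl).roots.toFinset := by
    rw [Multiset.mem_toFinset, Polynomial.mem_roots hne, Polynomial.IsRoot,
      ← Polynomial.coeff_zero_eq_eval_zero, Polynomial.coeff_map]
    intro h
    have hc : E.coeff 0 = 0 := toCp_injective <| by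
      rw [← coe_toAlgCl, h, map_zero, PadicComplex.coe_zero]
    exact hEis.notMem (by rw [hc]; exact Ideal.zero_mem _)
  have hT : (finite_torsion hf).toFinset = insert 0 (E.map toAlgCl).roots.toFinset := by
    ext z
    rw [Set.Finite.mem_toFinset, mem_torsion_iff hπ hE hdeg0 hEis hU hfE, Finset.mem_insert,
      Multiset.mem_toFinset, Polynomial.mem_roots hne, Polynomial.IsRoot, Polynomial.eval_map]
  rw [hT, Finset.card_insert_of_notMem h0, Multiset.toFinset_card_of_nodup
    (Polynomial.nodup_roots hsep), IsAlgClosed.card_roots_eq_natDegree, hE.natDegree_map, hdeg]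

/-- A power series that takes a value in `K` at a nonzero root of a Lubin-Tate series takes the
same value at all nonzero roots. -/
theorem evalAt_eq_of_mem_torsion (hπ : IsUniformizer π) (hf : IsLubinTateSeries π f)
    {g : (ringOfIntegers p K)⟦X⟧} {c : ringOfIntegers p K}
    {u : PadicAlgCl p} (hu : u ∈ torsion f) (hu0 : u ≠ 0) (hg : evalAt g u = toCp c)
    {z : PadicAlgCl p} (hz : z ∈ torsion f) (hz0 : z ≠ 0) : evalAt g z = toCp c := by
  obtain ⟨E, U, hE, hdeg, hEis, hU, hfE⟩ := exists_eisenstein_factor hπ hf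
  have hq := hf.two_le_card
  have hdeg0 : 0 < E.natDegree := by omega
  have hirr := irreducible_map_of_isEisensteinAt hE hdeg0 hEis
  obtain ⟨b, hb⟩ := exists_eq_sum_subst_mul hπ hf g
  -- At a root of `f` each `b i (f)` takes the value `b i (0)`, so there `g - c` agrees with this
  -- polynomial. It vanishes at `u`, hence is divisible over `K` by the minimal polynomial of `u`,
  -- the Eisenstein factor, which kills `z` too.
  let R : Polynomial (ringOfIntegers p K) := (∑ i ∈ Finset.range (Nat.card
    (IsLocalRing.ResidueField (ringOfIntegers p K))),
      Polynomial.C (constantCoeff (b i)) * Polynomial.X ^ i) - Polynomial.C c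
  have hmod : ∃ r, g = R + C c + f * r := by
    have h1 : ∀ i, ∃ r, ((b i).subst f : (ringOfIntegers p K)⟦X⟧) =
        C (constantCoeff (b i)) + f * r := by
      intro i
      obtain ⟨r, hr⟩ : X ∣ b i - C (constantCoeff (b i)) := X_dvd_iff.mpr (by simp)
      refine ⟨r.subst f, ?_⟩
      conv_lhs => rw [show b i = C (constantCoeff (b i)) + X * r by rw [← hr]; ring]
      rw [subst_add hf.hasSubst, subst_mul hf.hasSubst, subst_X hf.hasSubst, subst_C]
      rfl
    choose r hr using h1
    refine ⟨∑ i ∈ Finset.range (Nat.card (IsLocalRing.ResidueField (ringOfIntegers p K))),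
      r i * X ^ i, ?_⟩
    conv_lhs => rw [hb]
    simp only [hr, R, Polynomial.coe_sub, Polynomial.coe_C, sub_add_cancel, Finset.mul_sum]
    rw [← Polynomial.coeToPowerSeries.ringHom_apply, map_sum, ← Finset.sum_add_distrib]
    refine Finset.sum_congr rfl fun i _ => ?_
    rw [Polynomial.coeToPowerSeries.ringHom_apply, Polynomial.coe_mul, Polynomial.coe_C,
      Polynomial.coe_pow, Polynomial.coe_X]
    ring
  obtain ⟨r, hr⟩ := hmod
  have hval : ∀ x ∈ torsion f, evalAt g x = ((R.eval₂ toAlgCl x : PadicAlgCl p) : ℂ_[p]) +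
      toCp c := by
    rintro x ⟨hx, hx0⟩
    rw [← evalAt_coe R hx, hr, ← evalHom_apply hx, map_add, map_add, map_mul, evalHom_apply,
      evalHom_apply, evalHom_apply, hx0, evalAt_C, zero_mul, add_zero]
  have hEroot : ∀ x ∈ torsion f, x ≠ 0 →
      Polynomial.aeval x (E.map (algebraMap (ringOfIntegers p K) K)) = 0 := by
    intro x hx hx0
    rw [Polynomial.aeval_def, Polynomial.eval₂_map]
    exact ((mem_torsion_iff hπ hE hdeg0 hEis hU hfE).mp hx).resolve_left hx0
  have hRu : Polynomial.aeval u (R.map (algebraMap (ringOfIntegers p K) K)) = 0 := by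
    rw [Polynomial.aeval_def, Polynomial.eval₂_map]
    have h := hval u hu
    rw [hg, right_eq_add, PadicComplex.coe_eq, _root_.map_eq_zero] at h
    exact h
  have hdvd := minpoly.dvd K u hRu
  rw [← minpoly.eq_of_irreducible_of_monic hirr (hEroot u hu hu0) (hE.map _)] at hdvd
  obtain ⟨Q, hQ⟩ := hdvd
  have hRz : R.eval₂ toAlgCl z = 0 := by
    have h : Polynomial.aeval z (R.map (algebraMap (ringOfIntegers p K) K)) = 0 := by
      rw [hQ, map_mul, hEroot z hz hz0, zero_mul]
    rwa [Polynomial.aeval_def, Polynomial.eval₂_map] at h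
  rw [hval z hz, hRz, PadicComplex.coe_zero, zero_add]

/-- The trace of every power series exists. -/
theorem exists_isColemanTrace (hπ : IsUniformizer π) (hf : IsLubinTateSeries π f)
    (g : (ringOfIntegers p K)⟦X⟧) : ∃ h, IsColemanTrace hπ hf g h := by
  classical
  set q := Nat.card (IsLocalRing.ResidueField (ringOfIntegers p K)) with hqdef
  set T := (finite_torsion hf).toFinset with hT
  set F := formalGroup hπ hf with hF
  have hcard : T.card = q := card_torsion hπ hf
  have hmemT : ∀ z ∈ T, z ∈ torsion f := fun z hz => (finite_torsion hf).mem_toFinset.mp hz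
  let φ : (ringOfIntegers p K)⟦X⟧ →+* ℂ_[p]⟦X⟧ :=
    (PowerSeries.map toCp).comp (substAlgHom hf.hasSubst).toRingHom
  have hφ : ∀ b, φ b = PowerSeries.map toCp (b.subst f) := fun b =>
    congrArg (PowerSeries.map toCp) (congrFun (coe_substAlgHom hf.hasSubst) b)
  have htr : ∀ z ∈ T, ∀ b : ℕ → (ringOfIntegers p K)⟦X⟧,
      translate F (∑ i ∈ Finset.range q, (b i).subst f * X ^ i) z =
        ∑ i ∈ Finset.range q, φ (b i) * translate F X z ^ i := by
    intro z hz b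
    have hz1 := (hmemT z hz).1
    rw [← translateHom_apply F hz1, map_sum]
    refine Finset.sum_congr rfl fun i _ => ?_
    rw [map_mul, map_pow, translateHom_apply, translateHom_apply,
      translate_subst hπ hf _ (hmemT z hz), hφ]
  obtain ⟨b, hb⟩ := exists_eq_sum_subst_mul hπ hf (X ^ q)
  rw [← hqdef] at hb
  let R : Polynomial ℂ_[p]⟦X⟧ :=
    ∑ i ∈ Finset.range q, Polynomial.C (φ (b i)) * Polynomial.X ^ i
  have hRdeg : R.degree < q := by
    refine Polynomial.mem_degreeLT.mp (Submodule.sum_mem _ fun i hi => ?_)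
    exact Polynomial.mem_degreeLT.mpr (lt_of_le_of_lt (Polynomial.degree_C_mul_X_pow_le _ _)
      (by exact_mod_cast Finset.mem_range.mp hi))
  -- Both sides are monic of degree `q`, so their difference has smaller degree; it vanishes at the
  -- `q` translates `X ⊕ z`, which are distinct because their constant terms `z` are.
  have hprod : ∏ z ∈ T, (Polynomial.X - Polynomial.C (translate F X z)) =
      Polynomial.X ^ q - R := by
    have hm1 : (∏ z ∈ T, (Polynomial.X - Polynomial.C (translate F X z))).Monic :=
      Polynomial.monic_prod_of_monic _ _ fun z _ => Polynomial.monic_X_sub_C _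
    have hm2 : (Polynomial.X ^ q - R).Monic := Polynomial.monic_X_pow_sub hRdeg
    have hd1 : (∏ z ∈ T, (Polynomial.X - Polynomial.C (translate F X z))).degree =
        (q : WithBot ℕ) := by
      rw [Polynomial.degree_prod_of_monic _ _ fun z _ => Polynomial.monic_X_sub_C _]
      simp [hcard]
    have hd2 : (Polynomial.X ^ q - R).degree =
        (q : WithBot ℕ) := by
      rw [Polynomial.degree_sub_eq_left_of_degree_lt] <;> rw [Polynomial.degree_X_pow]
      exact hRdeg
    refine Polynomial.eq_of_degree_sub_lt_of_eval_index_eq T (v := translate F X) ?_ ?_ ?_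
    · intro z hz y hy hzy
      have h := congrArg constantCoeff hzy
      rw [constantCoeff_translate F X (hmemT z hz).1, constantCoeff_translate F X (hmemT y hy).1,
        evalAt_X, evalAt_X] at h
      exact UniformSpace.Completion.coe_injective _ h
    · rw [hcard]
      refine lt_of_lt_of_eq (Polynomial.degree_sub_lt_left (hd1.trans hd2.symm) hm1.ne_zero ?_) hd1
      rw [hm1.leadingCoeff, hm2.leadingCoeff]
    · intro z hz
      have h := htr z hz b
      -- Translating the relation `X ^ q = ∑ b i (f) X ^ i` fixes the coefficients and replaces `X`
      -- by `X ⊕ z`.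
      rw [← hb, ← translateHom_apply F (hmemT z hz).1, map_pow, translateHom_apply] at h
      rw [Polynomial.eval_prod, Finset.prod_eq_zero hz (by simp), Polynomial.eval_sub,
        Polynomial.eval_pow, Polynomial.eval_X, h, Polynomial.eval_finsetSum]
      simp
  have hpow : ∀ i, ∑ z ∈ T, translate F X z ^ i ∈ φ.range := by
    refine sum_pow_mem T _ φ.range fun n => ?_
    rw [hprod, Polynomial.coeff_sub, Polynomial.coeff_X_pow, Polynomial.finsetSum_coeff]
    refine Subring.sub_mem _ ?_ (Subring.sum_mem _ fun i _ => ?_)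
    · split_ifs
      · exact Subring.one_mem _
      · exact Subring.zero_mem _
    · rw [Polynomial.coeff_C_mul_X_pow]
      split_ifs
      · exact ⟨_, rfl⟩
      · exact Subring.zero_mem _
  obtain ⟨c, hc⟩ := exists_eq_sum_subst_mul hπ hf g
  rw [← hqdef] at hc
  have hmem : ∑ z ∈ T, translate F g z ∈ φ.range := by
    rw [hc, Finset.sum_congr rfl fun z hz => htr z hz c, Finset.sum_comm]
    refine Subring.sum_mem _ fun i _ => ?_
    rw [← Finset.mul_sum]
    exact Subring.mul_mem _ ⟨_, rfl⟩ (hpow i)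
  obtain ⟨h, hh⟩ := hmem
  exact ⟨h, by rw [IsColemanTrace, ← hφ, hh]⟩

end

/-! ### The contraction `g ↦ s g(f)` in the `X`-adic topology -/

section
variable {A : Type*} [CommRing A]

theorem eq_zero_of_forall_X_pow_dvd {g : A⟦X⟧} (h : ∀ n, X ^ n ∣ g) : g = 0 := by
  ext n
  exact X_pow_dvd_iff.mp (h (n + 1)) n (Nat.lt_succ_self n)

/-- Substituting `f` does not lower the order since `f(0) = 0`, and the factor `s` raises it by one.
No divisibility by `π` enters, so inversion is possible over any ring. -/
theorem X_pow_dvd_mul_subst {f s : A⟦X⟧} (hf0 : constantCoeff f = 0) (hs : X ∣ s) {n : ℕ}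
    {g : A⟦X⟧} (hg : X ^ n ∣ g) : X ^ (n + 1) ∣ s * g.subst f := by
  have hsub : HasSubst f := HasSubst.of_constantCoeff_zero hf0
  obtain ⟨r, rfl⟩ := hg
  rw [subst_mul hsub, subst_pow hsub, subst_X hsub, pow_succ']
  exact mul_dvd_mul hs (Dvd.dvd.mul_right (pow_dvd_pow_of_dvd (X_dvd_iff.mpr hf0) n) _)

theorem eq_zero_of_eq_mul_subst {f s : A⟦X⟧} (hf0 : constantCoeff f = 0) (hs : X ∣ s)
    {g : A⟦X⟧} (hg : g = s * g.subst f) : g = 0 := by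
  refine eq_zero_of_forall_X_pow_dvd fun n => ?_
  induction n with
  | zero => simp
  | succ n ih => rw [hg]; exact X_pow_dvd_mul_subst hf0 hs ih

/-- The operator `g ↦ s g(f)` is contracting for the `X`-adic topology when `X` divides `s`. -/
theorem exists_sub_mul_subst_eq {f s : A⟦X⟧} (hf0 : constantCoeff f = 0) (hs : X ∣ s)
    (c : A⟦X⟧) : ∃ g : A⟦X⟧, g - s * g.subst f = c := by
  have hsub : HasSubst f := HasSubst.of_constantCoeff_zero hf0
  let Φ : A⟦X⟧ → A⟦X⟧ := fun g => c + s * g.subst f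
  have hΦ : ∀ {n : ℕ} {g h : A⟦X⟧}, X ^ n ∣ g - h → X ^ (n + 1) ∣ Φ g - Φ h := by
    intro n g h hgh
    have := X_pow_dvd_mul_subst hf0 hs hgh
    rwa [subst_sub hsub, mul_sub, ← add_sub_add_left_eq_sub _ _ c] at this
  let G : ℕ → A⟦X⟧ := fun n => Φ^[n] 0
  have hG : ∀ n, G (n + 1) = Φ (G n) := fun n => Function.iterate_succ_apply' Φ n 0
  have hstep : ∀ n, X ^ n ∣ G (n + 1) - G n := by
    intro n
    induction n with
    | zero => simp
    | succ n ih => rw [hG (n + 1), hG n]; rw [hG n] at ih; exact hΦ ih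
  have hstab : ∀ n k, X ^ n ∣ G (n + k) - G n := by
    intro n k
    induction k with
    | zero => simp
    | succ k ih =>
      have h := dvd_add ((pow_dvd_pow X (Nat.le_add_right n k)).trans (hstep (n + k))) ih
      rwa [sub_add_sub_cancel] at h
  -- The iterates agree modulo `X ^ n` from index `n` on, so the coefficient of degree `j` is final
  -- at index `j + 1`.
  let g : A⟦X⟧ := PowerSeries.mk fun j => coeff j (G (j + 1))
  have hg : ∀ n, X ^ n ∣ g - G n := by
    intro n
    rw [X_pow_dvd_iff]
    intro j hj
    obtain ⟨k, rfl⟩ := Nat.exists_eq_add_of_le (Nat.succ_le_of_lt hj)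
    have h := X_pow_dvd_iff.mp (hstab (j + 1) k) j (Nat.lt_succ_self j)
    rw [map_sub, sub_eq_zero] at h ⊢
    rw [coeff_mk]
    exact h.symm
  refine ⟨g, ?_⟩
  have h0 : g - Φ g = 0 := by
    refine eq_zero_of_forall_X_pow_dvd fun n => ?_
    have h := dvd_sub ((pow_dvd_pow X n.le_succ).trans (hg (n + 1)))
      ((pow_dvd_pow X n.le_succ).trans (hΦ (hg n)))
    rwa [hG, sub_sub_sub_cancel_right] at h
  linear_combination h0

end

/-! ### Completeness of the ring of integers and the auxiliary series -/

section
variable {A : Type*} [CommRing A] [IsLocalRing A] [IsDomain A]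

/-- A Lubin-Tate series has the form `X (π a + X ^ (q - 1) b)` with `a(0) = 1`. -/
theorem exists_eq_X_mul_add {π : A} (hπ : IsUniformizer π) {f : A⟦X⟧}
    (hf : IsLubinTateSeries π f) :
    ∃ a b : A⟦X⟧, constantCoeff a = 1 ∧
      f = X * (C π * a + X ^ (Nat.card (IsLocalRing.ResidueField A) - 1) * b) := by
  set q := Nat.card (IsLocalRing.ResidueField A) with hqdef
  have hq : 2 ≤ q := hf.two_le_card
  have hdvd : ∀ i, ∃ c, coeff (i + 1) f = π * c + if q - 1 ≤ i then coeff (i + 1) f else 0 := by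
    intro i
    split_ifs with hi
    · exact ⟨0, by ring⟩
    · have h : π ∣ coeff (i + 1) f := by
        rw [← hπ.residue_eq_zero_iff, ← coeff_map, hf.map_residue_eq, coeff_X_pow,
          if_neg (by omega)]
      obtain ⟨c, hc⟩ := h
      exact ⟨c, by rw [hc, add_zero]⟩
  choose a ha using hdvd
  have h0 := ha 0
  rw [if_neg (by omega), zero_add, hf.coeff_one_eq, add_zero] at h0
  refine ⟨PowerSeries.mk a, PowerSeries.mk fun i => coeff (i + q) f, ?_, ?_⟩
  · rw [← coeff_zero_eq_constantCoeff_apply, coeff_mk]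
    exact mul_left_cancel₀ hπ.ne_zero (by rw [← h0, mul_one])
  · ext n
    rcases n with _ | n
    · simp [hf.constantCoeff_eq]
    · rw [coeff_succ_X_mul, map_add, coeff_C_mul, coeff_mk, coeff_X_pow_mul', ha n]
      congr 1
      split_ifs with hn
      · rw [coeff_mk]
        congr 2
        omega
      · rfl

end

section
variable {p : ℕ} [Fact p.Prime] {K : Type*} [Field K] [Algebra K (PadicAlgCl p)]
  {π : ringOfIntegers p K} {f : (ringOfIntegers p K)⟦X⟧}

/-- Divisibility by `π ^ n` is the norm bound `‖π‖ ^ n`, so adic Cauchy sequences are Cauchy in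
norm; a limit exists in `K` and inherits the closed conditions. -/
theorem isAdicComplete_ringOfIntegers (hπ : IsUniformizer π)
    (hK : IsComplete (Set.range (algebraMap K (PadicAlgCl p)))) :
    IsAdicComplete (IsLocalRing.maximalIdeal (ringOfIntegers p K)) (ringOfIntegers p K) := by
  have hπ1 : ‖(toAlgCl π : PadicAlgCl p)‖ < 1 := by
    rw [norm_toAlgCl, norm_toCp_lt_one_iff hπ]
  have hdvd : ∀ {n : ℕ} {x : ringOfIntegers p K},
      π ^ n ∣ x ↔ ‖toAlgCl x‖ ≤ ‖toAlgCl π‖ ^ n := by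
    intro n x
    rw [← norm_pow, ← map_pow]
    constructor
    · rintro ⟨c, rfl⟩
      rw [map_mul, norm_mul]
      refine mul_le_of_le_one_right (norm_nonneg _) ?_
      rw [norm_toAlgCl]
      exact norm_toCp_le c
    · exact dvd_of_norm_le (pow_ne_zero n hπ.ne_zero)
  have hlim := tendsto_pow_atTop_nhds_zero_of_lt_one (norm_nonneg (toAlgCl π : PadicAlgCl p)) hπ1
  refine { haus' := fun x hx => ?_, prec' := fun {c} hc => ?_ }
  · have h : ‖toAlgCl x‖ ≤ 0 := ge_of_tendsto' hlim fun n => by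
      have h := hx n
      rw [SModEq.zero, hπ.mem_maximalIdeal_pow] at h
      exact hdvd.mp h
    have h0 : (x : K) = 0 := (map_eq_zero (algebraMap K (PadicAlgCl p))).mp (norm_le_zero_iff.mp h)
    exact Subtype.ext h0
  · have hc' : ∀ {m n : ℕ}, m ≤ n → ‖toAlgCl (c m) - toAlgCl (c n)‖ ≤ ‖toAlgCl π‖ ^ m := by
      intro m n hmn
      have h := hc hmn
      rw [SModEq.sub_mem, hπ.mem_maximalIdeal_pow, hdvd, map_sub] at h
      exact h
    have hcau : CauchySeq fun n => (toAlgCl (c n) : PadicAlgCl p) := by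
      refine cauchySeq_of_le_geometric ‖toAlgCl π‖ 1 hπ1 fun n => ?_
      rw [dist_eq_norm, one_mul]
      exact hc' n.le_succ
    obtain ⟨_, ⟨s, rfl⟩, hs⟩ := cauchySeq_tendsto_of_isComplete hK
      (fun n => ⟨(c n : K), rfl⟩) hcau
    have hs1 : s ∈ ringOfIntegers p K := by
      rw [mem_ringOfIntegers]
      exact le_of_tendsto' hs.norm fun n => (mem_ringOfIntegers p _).mp (c n).2
    refine ⟨⟨s, hs1⟩, fun n => ?_⟩
    rw [SModEq.sub_mem, hπ.mem_maximalIdeal_pow, hdvd, map_sub]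
    refine le_of_tendsto (tendsto_const_nhds.sub hs).norm ?_
    filter_upwards [Filter.eventually_ge_atTop n] with m hm
    exact hc' hm

/-- A finite extension of a finite extension of `ℚ_[p]` is complete. -/
theorem isComplete_range_algebraMap (L : Type*) [Field L] [Algebra ℚ_[p] L] [Algebra L K]
    [Algebra L (PadicAlgCl p)] [IsScalarTower ℚ_[p] L (PadicAlgCl p)]
    [IsScalarTower L K (PadicAlgCl p)] [FiniteDimensional ℚ_[p] L] [FiniteDimensional L K] :
    IsComplete (Set.range (algebraMap K (PadicAlgCl p))) := by
  -- Over `ℚ_[p]`, acting on `K` through `L`, the image of `K` is a finite-dimensional subspace,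
  -- hence complete.
  let _ : Algebra ℚ_[p] K := ((algebraMap L K).comp (algebraMap ℚ_[p] L)).toAlgebra
  have : IsScalarTower ℚ_[p] L K := IsScalarTower.of_algebraMap_eq fun _ => rfl
  have : IsScalarTower ℚ_[p] K (PadicAlgCl p) := IsScalarTower.of_algebraMap_eq fun x => by
    rw [IsScalarTower.algebraMap_apply ℚ_[p] L (PadicAlgCl p),
      IsScalarTower.algebraMap_apply L K (PadicAlgCl p)]
    rfl
  have : FiniteDimensional ℚ_[p] K := FiniteDimensional.trans ℚ_[p] L K
  have h := (LinearMap.range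
    (IsScalarTower.toAlgHom ℚ_[p] K (PadicAlgCl p)).toLinearMap).complete_of_finiteDimensional
  convert h using 1
  ext x
  rfl

/-- `q` vanishes in the residue field, so `q - 1` reduces to `-1`. -/
theorem exists_unit_card_sub_one (hf : IsLubinTateSeries π f) :
    ∃ v v' : ringOfIntegers p K, v * v' = 1 ∧ toCp v =
      (Nat.card (IsLocalRing.ResidueField (ringOfIntegers p K)) : ℂ_[p]) - 1 := by
  have : Finite (IsLocalRing.ResidueField (ringOfIntegers p K)) :=
    Nat.finite_of_card_ne_zero (card_residueField_ne_zero hf)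
  have := Fintype.ofFinite (IsLocalRing.ResidueField (ringOfIntegers p K))
  have hu : IsUnit ((Nat.card (IsLocalRing.ResidueField (ringOfIntegers p K)) :
      ringOfIntegers p K) - 1) := by
    rw [← IsLocalRing.residue_ne_zero_iff_isUnit, map_sub, map_natCast, map_one,
      Nat.card_eq_fintype_card, FiniteField.cast_card_eq_zero, zero_sub]
    exact neg_ne_zero.mpr one_ne_zero
  obtain ⟨v', hv'⟩ := hu.exists_right_inv
  exact ⟨_, v', hv', by rw [map_sub, map_natCast, map_one]⟩

theorem exists_isAuxiliarySeries (hπ : IsUniformizer π) (hf : IsLubinTateSeries π f)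
    {u : PadicAlgCl p} (hu : u ∈ torsion f) (hu0 : u ≠ 0) : ∃ k, IsAuxiliarySeries π u k := by
  obtain ⟨a, b, ha, hfab⟩ := exists_eq_X_mul_add hπ hf
  obtain ⟨v, v', hv, hvq⟩ := exists_unit_card_sub_one hf
  have hau : IsUnit a := isUnit_iff_constantCoeff.mpr (by rw [ha]; exact isUnit_one)
  obtain ⟨a', ha'⟩ := hau.exists_right_inv
  obtain ⟨hu1, huf⟩ := hu
  -- Cancelling `u` in `f(u) = 0` leaves `π a(u) + u ^ (q - 1) b(u) = 0`, so `-X ^ (q - 1) b a⁻¹`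
  -- takes the value `π` at `u`; divide by `q - 1`.
  refine ⟨_, ⟨Dvd.intro (-(b * a') * C v') rfl, ?_⟩⟩
  have h1 : (u : ℂ_[p]) ≠ 0 := by
    rw [PadicComplex.coe_eq]; exact (_root_.map_ne_zero _).mpr hu0
  have h2 := huf
  rw [← evalHom_apply hu1, hfab, map_mul, map_add, map_mul, map_mul, map_pow, evalHom_apply hu1 X,
    evalAt_X, evalHom_apply hu1 (C π), evalAt_C] at h2
  have h3 := (mul_eq_zero.mp h2).resolve_left h1
  have h4 : evalHom hu1 a * evalHom hu1 a' = 1 := by rw [← map_mul, ha', map_one]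
  have h5 : toCp v * toCp v' = 1 := by rw [← map_mul, hv, map_one]
  have h6 : toCp v ≠ 0 := left_ne_zero_of_mul_eq_one h5
  rw [← hvq, eq_div_iff h6, ← evalHom_apply hu1, map_mul, map_mul, map_neg, map_mul, map_pow,
    evalHom_apply hu1 X, evalAt_X, evalHom_apply hu1 (C v'), evalAt_C]
  linear_combination (-evalHom hu1 a' * toCp v * toCp v') * h3 + toCp π * toCp v * toCp v' * h4 +
    toCp π * h5

theorem evalAt_zero_of_X_dvd {g : (ringOfIntegers p K)⟦X⟧} (hg : X ∣ g) :
    evalAt g (0 : PadicAlgCl p) = 0 := by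
  obtain ⟨r, rfl⟩ := hg
  rw [← evalHom_apply (by rw [norm_zero]; exact one_pos), map_mul, evalHom_apply, evalAt_X,
    PadicComplex.coe_zero, zero_mul]

theorem zero_mem_torsion (hf : IsLubinTateSeries π f) : (0 : PadicAlgCl p) ∈ torsion f :=
  ⟨by rw [norm_zero]; exact one_pos, evalAt_zero_of_X_dvd (X_dvd_iff.mpr hf.constantCoeff_eq)⟩

theorem IsAuxiliarySeries.X_dvd (hf : IsLubinTateSeries π f) {u : PadicAlgCl p}
    {k : (ringOfIntegers p K)⟦X⟧} (hk : IsAuxiliarySeries π u k) : X ∣ k :=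
  (dvd_pow_self X (by have := hf.two_le_card; omega)).trans hk.X_pow_dvd

/-- The trace of an auxiliary series is `π w` with `w(0) = 1`. -/
theorem constantCoeff_eq_one_of_isColemanTrace
    [IsAdicComplete (IsLocalRing.maximalIdeal (ringOfIntegers p K)) (ringOfIntegers p K)]
    {hπ : IsUniformizer π} {hf : IsLubinTateSeries π f}
    {u : PadicAlgCl p} (hu : u ∈ torsion f) (hu0 : u ≠ 0) {k w : (ringOfIntegers p K)⟦X⟧}
    (hk : IsAuxiliarySeries π u k) (hw : IsColemanTrace hπ hf k (C π * w)) :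
    constantCoeff w = 1 := by
  classical
  obtain ⟨v, v', hv, hvq⟩ := exists_unit_card_sub_one hf
  have h5 : toCp v * toCp v' = 1 := by rw [← map_mul, hv, map_one]
  have h6 : toCp v ≠ 0 := left_ne_zero_of_mul_eq_one h5
  -- The prescribed value is the integral element `π v⁻¹` of `K`, with `v = q - 1`; it is therefore
  -- shared by all `q - 1` nonzero roots, whose total contribution is `π`.
  have hku : evalAt k u = toCp (π * v') := by
    rw [hk.evalAt_eq, ← hvq, map_mul, div_eq_iff h6]
    linear_combination (-toCp π) * h5
  have h0 : (0 : PadicAlgCl p) ∈ (finite_torsion hf).toFinset :=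
    (finite_torsion hf).mem_toFinset.mpr (zero_mem_torsion hf)
  have h := congrArg constantCoeff hw
  rw [map_sum, ← Finset.add_sum_erase _ _ h0,
    constantCoeff_translate _ _ (zero_mem_torsion hf).1,
    evalAt_zero_of_X_dvd (hk.X_dvd hf), zero_add,
    Finset.sum_congr rfl (g := fun _ => toCp (π * v')) fun z hz => by
      obtain ⟨hz0, hz⟩ := Finset.mem_erase.mp hz
      have hz' := (finite_torsion hf).mem_toFinset.mp hz
      rw [constantCoeff_translate _ _ hz'.1, evalAt_eq_of_mem_torsion hπ hf hu hu0 hku hz' hz0],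
    Finset.sum_const, Finset.card_erase_of_mem h0, card_torsion hπ hf, nsmul_eq_mul,
    Nat.cast_sub (by have := hf.two_le_card; omega), Nat.cast_one, ← hvq,
    ← coeff_zero_eq_constantCoeff_apply, coeff_map, coeff_zero_eq_constantCoeff_apply,
    constantCoeff_subst_of_constantCoeff_zero hf.constantCoeff_eq, map_mul, constantCoeff_C,
    ← map_mul] at h
  have h' := toCp_injective h
  refine mul_left_cancel₀ hπ.ne_zero ?_
  linear_combination h' + π * hv

theorem IsColemanTrace.sub {hπ : IsUniformizer π} {hf : IsLubinTateSeries π f}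
    {g₁ g₂ h₁ h₂ : (ringOfIntegers p K)⟦X⟧}
    (H₁ : IsColemanTrace hπ hf g₁ h₁) (H₂ : IsColemanTrace hπ hf g₂ h₂) :
    IsColemanTrace hπ hf (g₁ - g₂) (h₁ - h₂) := by
  have h := H₁.add (H₂.C_mul (-1))
  simpa [sub_eq_add_neg] using h

/-! ### The isomorphism over the ring of integers of `L` -/

section Relative
variable {L : Type*} [Field L] [Algebra L (PadicAlgCl p)] [Algebra L K]
  [IsScalarTower L K (PadicAlgCl p)]

theorem toCp_algebraMap (a : ringOfIntegers p L) :
    toCp (algebraMap (ringOfIntegers p L) (ringOfIntegers p K) a) = toCp a := by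
  have h : toAlgCl (algebraMap (ringOfIntegers p L) (ringOfIntegers p K) a) = toAlgCl a :=
    (IsScalarTower.algebraMap_apply L K (PadicAlgCl p) (a : L)).symm
  rw [← coe_toAlgCl, h, coe_toAlgCl]

theorem uniformizer_dvd_algebraMap (hπ : IsUniformizer π) {πL : ringOfIntegers p L}
    (hπL : IsUniformizer πL) :
    π ∣ algebraMap (ringOfIntegers p L) (ringOfIntegers p K) πL := by
  rw [← norm_toCp_lt_one_iff hπ, toCp_algebraMap, norm_toCp_lt_one_iff hπL]

/-- The map `g ↦ g - k (b g)(f)`. -/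
def subMulSubst (hf : IsLubinTateSeries π f) (k b : (ringOfIntegers p K)⟦X⟧) :
    (ringOfIntegers p K)⟦X⟧ →ₗ[ringOfIntegers p L] (ringOfIntegers p K)⟦X⟧ where
  toFun g := g - (b * g).subst f * k
  map_add' g h := by
    rw [mul_add, subst_add hf.hasSubst]; ring
  map_smul' a g := by
    rw [RingHom.id_apply, smul_eq_C_algebraMap_mul, smul_eq_C_algebraMap_mul, mul_left_comm,
      subst_C_mul hf.hasSubst]
    ring

/-- With `γ = α / π` and `w' = w⁻¹` the map `ρ_α` is already integral; its linear operator is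
bijective on the whole of `𝓞_K⟦X⟧`, and it remains only to match the two submodules. -/
theorem exists_linearEquiv {hπ : IsUniformizer π} {hf : IsLubinTateSeries π f}
    {πL α : ringOfIntegers p L} {γ : ringOfIntegers p K}
    (hγ : algebraMap (ringOfIntegers p L) (ringOfIntegers p K) α = π * γ)
    {k w w' : (ringOfIntegers p K)⟦X⟧} (hk : X ∣ k) (hw : IsColemanTrace hπ hf k (C π * w))
    (hww : w * w' = 1) :
    ∃ ρ : eigenspace hπ hf πL α ≃ₗ[ringOfIntegers p L] traceKernel hπ hf πL,
      ∀ g : eigenspace hπ hf πL α, (ρ g : (ringOfIntegers p K)⟦X⟧) =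
        g - (C γ * w' * g).subst f * k := by
  set ρ : (ringOfIntegers p K)⟦X⟧ →ₗ[ringOfIntegers p L] (ringOfIntegers p K)⟦X⟧ :=
    subMulSubst hf k (C γ * w') with hρdef
  have hρ : ∀ g, ρ g = g - (C γ * w' * g).subst f * k := fun g => rfl
  -- Linearity over series in `f`: the trace is `γ w' g · π w = α g`, for every `g`.
  have htrace : ∀ g, IsColemanTrace hπ hf (((C γ * w' * g).subst f) * k) (α • g) := by
    intro g
    have h := hw.subst_mul (C γ * w' * g)
    have e : C γ * w' * g * (C π * w) = α • g := by
      rw [smul_eq_C_algebraMap_mul, hγ, map_mul]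
      linear_combination C γ * C π * g * hww
    rwa [e] at h
  have hcontr : ∀ g : (ringOfIntegers p K)⟦X⟧, ((C γ * w' * g).subst f) * k =
      (((C γ * w').subst f : (ringOfIntegers p K)⟦X⟧) * k) * g.subst f := fun g => by
    rw [subst_mul hf.hasSubst]; ring
  have hX : X ∣ ((C γ * w').subst f : (ringOfIntegers p K)⟦X⟧) * k := Dvd.dvd.mul_left hk _
  have hmaps : ∀ g ∈ eigenspace hπ hf πL α, ρ g ∈ traceKernel hπ hf πL := by
    rintro g ⟨⟨g', rfl⟩, hg⟩
    refine ⟨⟨ρ g', map_smul ρ πL g'⟩, ?_⟩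
    have h := hg.sub (htrace (πL • g'))
    rwa [sub_self] at h
  refine ⟨LinearEquiv.ofBijective (ρ.restrict hmaps) ⟨?_, ?_⟩, fun g => rfl⟩
  · rw [injective_iff_map_eq_zero]
    intro g hg
    have h : ρ g = 0 := congrArg Subtype.val hg
    rw [hρ, sub_eq_zero, hcontr] at h
    exact Subtype.ext (eq_zero_of_eq_mul_subst hf.constantCoeff_eq hX h)
  · rintro ⟨_, ⟨c, rfl⟩, hc⟩
    -- Inverting at `c` rather than at `πL • c` makes the preimage `πL • g` visibly divisible by
    -- `πL`.
    obtain ⟨g, hg⟩ := exists_sub_mul_subst_eq hf.constantCoeff_eq hX c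
    have hρg : ρ g = c := by rw [hρ, hcontr, hg]
    have hρg' : ρ (πL • g) = πL • c := by rw [map_smul, hρg]
    have hmem : πL • g ∈ eigenspace hπ hf πL α := by
      refine ⟨⟨g, rfl⟩, ?_⟩
      have h := hc.add (htrace (πL • g))
      rw [← hρg', hρ, sub_add_cancel, zero_add] at h
      exact h
    exact ⟨⟨_, hmem⟩, Subtype.ext hρg'⟩

/-- The denominator `π w(f)` has nonzero constant term in `K`, so its inverse in `K⟦X⟧` is genuine,
and the factor `π` of `α` cancels the `π` below. -/
theorem toFractions_sub_eq_rho (hπ : IsUniformizer π) (hf : IsLubinTateSeries π f)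
    {α : ringOfIntegers p L} {γ : ringOfIntegers p K}
    (hγ : algebraMap (ringOfIntegers p L) (ringOfIntegers p K) α = π * γ)
    {k w w' : (ringOfIntegers p K)⟦X⟧} (hww : w * w' = 1) (g : (ringOfIntegers p K)⟦X⟧) :
    toFractions (g - (C γ * w' * g).subst f * k) = rho π f α k w g := by
  have hC : ∀ a : ringOfIntegers p K, toFractions (C a) = C (a : K) := fun a => map_C _ a
  have hW : (w.subst f : (ringOfIntegers p K)⟦X⟧) * w'.subst f = 1 := by
    rw [← subst_mul hf.hasSubst, hww, ← coe_substAlgHom hf.hasSubst, map_one]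
  have hunit : IsUnit (toFractions (w.subst f : (ringOfIntegers p K)⟦X⟧)) :=
    (IsUnit.of_mul_eq_one _ hW).map toFractions
  have hne : constantCoeff (C (π : K) * toFractions (w.subst f : (ringOfIntegers p K)⟦X⟧)) ≠ 0 := by
    rw [map_mul, constantCoeff_C]
    exact mul_ne_zero (fun h => hπ.ne_zero (Subtype.ext h))
      (isUnit_iff_constantCoeff.mp hunit).ne_zero
  rw [rho, map_sub]
  congr 1
  rw [PowerSeries.eq_mul_inv_iff_mul_eq hne, ← hC, ← coe_algebraMap_integers, ← hC, ← map_mul,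
    ← map_mul, ← map_mul, ← map_mul, hγ, map_mul (C (R := ringOfIntegers p K)) π γ, subst_mul hf.hasSubst,
    subst_mul hf.hasSubst, subst_C]
  refine congrArg toFractions ?_
  change C γ * w'.subst f * g.subst f * k * (C π * w.subst f) = C π * C γ * k * g.subst f
  linear_combination C γ * C π * (g.subst f : (ringOfIntegers p K)⟦X⟧) * k * hW

end Relative

end

end LubinTate

end

theorem theorem2p0p4 (p : ℕ) [Fact p.Prime]
    {L K : Type*} [Field L] [Field K] [Algebra ℚ_[p] L] [Algebra L K]
    [Algebra L (PadicAlgCl p)] [Algebra K (PadicAlgCl p)]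
    [IsScalarTower ℚ_[p] L (PadicAlgCl p)] [IsScalarTower L K (PadicAlgCl p)]
    [FiniteDimensional ℚ_[p] L] [FiniteDimensional L K]
    (πL : ringOfIntegers p L) (hπL : IsUniformizer πL)
    (πK : ringOfIntegers p K) (hπK : IsUniformizer πK)
    (f : (ringOfIntegers p K)⟦X⟧) (hf : IsLubinTateSeries πK f)
    (u₀ : PadicAlgCl p) (hu₀ : u₀ ∈ torsion f) (hu₀' : u₀ ≠ 0)
    (α : ringOfIntegers p L) (hα : πL ∣ α) :
    (∃ k, IsAuxiliarySeries πK u₀ k) ∧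
    ∀ k, IsAuxiliarySeries πK u₀ k →
      (∃! w, IsColemanTrace hπK hf k (C πK * w)) ∧
      ∀ w, IsColemanTrace hπK hf k (C πK * w) →
        IsUnit (w.subst f : (ringOfIntegers p K)⟦X⟧) ∧
        ∃ ρ : eigenspace hπK hf πL α ≃ₗ[ringOfIntegers p L] traceKernel hπK hf πL,
          ∀ g : eigenspace hπK hf πL α,
            toFractions (ρ g : (ringOfIntegers p K)⟦X⟧) = rho πK f α k w g := by
  have : IsAdicComplete (IsLocalRing.maximalIdeal (ringOfIntegers p K)) (ringOfIntegers p K) :=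
    isAdicComplete_ringOfIntegers hπK (isComplete_range_algebraMap L)
  refine ⟨exists_isAuxiliarySeries hπK hf hu₀ hu₀', fun k hk => ⟨?_, fun w hw => ?_⟩⟩
  · obtain ⟨h, hh⟩ := exists_isColemanTrace hπK hf k
    obtain ⟨w, rfl⟩ := hh.C_dvd (card_torsion hπK hf)
    refine ⟨w, hh, fun w₂ hw₂ => ?_⟩
    have hC : (C πK : (ringOfIntegers p K)⟦X⟧) ≠ 0 := fun h0 => hπK.ne_zero <| by
      rw [← constantCoeff_C πK, h0, map_zero]
    exact mul_left_cancel₀ hC (hw₂.unique hh)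
  · have hw0 := constantCoeff_eq_one_of_isColemanTrace hu₀ hu₀' hk hw
    have hwu : IsUnit w := isUnit_iff_constantCoeff.mpr (by rw [hw0]; exact isUnit_one)
    refine ⟨isUnit_iff_constantCoeff.mpr ?_, ?_⟩
    · rw [constantCoeff_subst_of_constantCoeff_zero hf.constantCoeff_eq, hw0]
      exact isUnit_one
    · obtain ⟨w', hww⟩ := hwu.exists_right_inv
      -- `πK ∣ πL ∣ α`: this is where the hypothesis on `α` makes `α / πK` integral.
      obtain ⟨γ, hγ⟩ := (uniformizer_dvd_algebraMap hπK hπL).trans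
        (map_dvd (algebraMap (ringOfIntegers p L) (ringOfIntegers p K)) hα)
      obtain ⟨ρ, hρ⟩ := exists_linearEquiv (πL := πL) hγ (hk.X_dvd hf) hw hww
      exact ⟨ρ, fun g => by rw [hρ, toFractions_sub_eq_rho hπK hf hγ hww]⟩
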